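/- Let $k\ge 2$ be an integer and let $\alpha\in\mathbb{C}$ with $|\alpha|<2$. For an integer $N\ge 2$ let $$\mathfrak X_N^{(k)}=\Big\{\prod_{p\le N,\ p\text{ prime}}p^{\nu(p)}:\ 0\le \nu(p)\le k-1\Big\}$$ be the finite set of all $k$-free positive integers whose prime factors do not exceed $N$. Let $\Omega(x)$ be the number of prime factors of $x$ counted with multiplicity (with the convention $0^0=1$), and put $$P_\Omega^{(\alpha)}(X)=\sum_{x\in X}\frac{\alpha^{\Omega(x)}}{x}\quad (X\subseteq \mathfrak X_N^{(k)}),\qquad Z_{\Omega,N}^{(k,\alpha)}=P_\Omega^{(\alpha)}(\mathfrak X_N^{(k)}),\qquad P_{\Omega,N}^{(k,\alpha)}=\big(Z_{\Omega,N}^{(k,\alpha)}\big)^{-1}P_\Omega^{(\alpha)},\qquad \xi_N(x)=\frac{\log x}{\log N}.$$ For $\lambda\in\mathbb{R}$ let $$\varphi_{\Omega,N}^{(k,\alpha)}(\lambda)=\sum_{x\in\mathfrak X_N^{(k)}}e^{i\lambda\xi_N(x)}\,P_{\Omega,N}^{(k,\alpha)}(\{x\}),\qquad \varphi^{(\alpha)}(\lambda)=\exp\Big(\alpha\int_0^1\frac{e^{i\lambda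 v}-1}{v}\,dv\Big).$$ Then there is a constant $C$ depending only on $k$ and $\alpha$ such that, for every real sequence $\lambda=\lambda(N)$ with $\lambda=o(\log N)$ as $N\to\infty$, for all sufficiently large $N$ (how large may depend on the sequence), writing $\varepsilon=\lambda/\log N$, $$\varphi_{\Omega,N}^{(k,\alpha)}(\lambda)=\varphi^{(\alpha)}(\lambda)\,(1+E_1+E_2)$$ for some complex numbers $E_1,E_2$ with $$|E_1|\le \frac{C}{\log N},\qquad |E_2|\le C\,\big|\varepsilon\log|\varepsilon|\big|,$$ where $\varepsilon\log|\varepsilon|$ is read as $0$ when $\varepsilon=0$. In other words, $\varphi_{\Omega,N}^{(k,\alpha)}(\lambda)=\varphi^{(\alpha)}(\lambda)\big(1+O(1/\log N)+O(\varepsilon\log|\varepsilon|)\big)$ with implied constants depending only on $k$ and $\alpha$. -/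

import Mathlib

noncomputable section

namespace KFreeSmooth

/-- The set of primes `p ≤ N`. -/
def primesUpTo (N : ℕ) : Finset ℕ := {p ∈ Finset.range (N + 1) | p.Prime}

/-- The ensemble `𝔛_N^{(k)} = {∏_{p ≤ N} p ^ ν(p) : 0 ≤ ν(p) ≤ k - 1}` of all `k`-free integers
whose prime factors do not exceed `N`. -/
def ensemble (k N : ℕ) : Finset ℕ :=
  Finset.univ.image fun ν : primesUpTo N → Fin k => ∏ p : primesUpTo N, (p : ℕ) ^ (ν p : ℕ)

/-- The complex measure `P_Ω^{(α)}(X) = ∑_{x ∈ X} α ^ Ω(x) / x`, where `Ω` counts prime factors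
with multiplicity. -/
def cmeasure (α : ℂ) (X : Finset ℕ) : ℂ :=
  ∑ x ∈ X, α ^ ArithmeticFunction.cardFactors x / (x : ℂ)

/-- The partition function `Z_{Ω,N}^{(k,α)} = P_Ω^{(α)}(𝔛_N^{(k)})`. -/
def partitionFunction (k : ℕ) (α : ℂ) (N : ℕ) : ℂ := cmeasure α (ensemble k N)

/-- The normalized complex measure `P_{Ω,N}^{(k,α)} = (Z_{Ω,N}^{(k,α)})⁻¹ P_Ω^{(α)}`. -/
def normalizedMeasure (k : ℕ) (α : ℂ) (N : ℕ) (X : Finset ℕ) : ℂ :=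
  (partitionFunction k α N)⁻¹ * cmeasure α X

/-- The random variable `ξ_N(x) = log x / log N`. -/
def xi (N x : ℕ) : ℝ := Real.log x / Real.log N

/-- The expectation of `g` with respect to `P_{Ω,N}^{(k,α)}` on the finite set `𝔛_N^{(k)}`. -/
def expectation (k : ℕ) (α : ℂ) (N : ℕ) (g : ℕ → ℂ) : ℂ :=
  ∑ x ∈ ensemble k N, g x * normalizedMeasure k α N {x}

/-- The characteristic function `φ_{Ω,N}^{(k,α)}(t)`, the expectation of `exp (i t ξ_N)`. -/
def charFn (k : ℕ) (α : ℂ) (N : ℕ) (t : ℝ) : ℂ :=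
  expectation k α N fun x => Complex.exp (Complex.I * (t : ℂ) * (xi N x : ℂ))

/-- `φ^{(α)}(t) = exp (α ∫_0^1 (e^{i t v} - 1) / v dv)`, the characteristic function of the
`α`-convolution of the Dickman-de Bruijn distribution. -/
def limitCharFn (α : ℂ) (t : ℝ) : ℂ :=
  Complex.exp (α * ∫ v in (0 : ℝ)..1, (Complex.exp (Complex.I * (t : ℂ) * (v : ℂ)) - 1) / (v : ℂ))

end KFreeSmooth

end

/-! Since `x ↦ α ^ Ω(x) / x` is completely multiplicative, the characteristic function is a product
over p ≤ N of G(α p^{iε} / p) / G(α / p), where G is the truncated geometric series and ε = λ / log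
N. As k ≥ 2, G(w) e^{-w} = 1 + O(w²), so each factor is exp(α (p^{iε} - 1) / p) up to a relative
error O(|ε| log p / p²). These errors multiply to 1 + O(ε) (`exists_charFn_eq_exp_mul`).

It remains to compare ∑ (p^{iε} - 1) / p with ∫_2^N (t^{iε} - 1) / (t log t) dt. Under t = N^v this
is the integral in the limit law, short of a piece of size O(ε). Abel summation against Mertens'
first theorem has error O(1 / log N + |ε| log log N), good enough only while log N ≤ ε⁻². Past y =
exp(ε⁻²) a twisted Mertens bound takes over: ∑_{p ≤ t} p^{-1+iε} log p = O(1 / |ε|) uniformly in t.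
Divided by log y, it costs only O(ε).

The twisted bound (`norm_sum_vonMangoldt_mul_unitPow_div_le`) is elementary. Summing log = Λ * 1
against n^{-1+iε} gives r S = O(1 / ε²), where S is the twisted sum of Λ and r stands in for ζ(1 -
iε). The pole of ζ makes |r| at least of order 1 / |ε|, whence the bound on S. -/

namespace KFreeSmooth

open Finset MeasureTheory

/-! ### Abel summation with an approximate summatory function -/

/-- Abel summation against a function `H` that approximates the partial sums up to `K`. -/
theorem norm_sum_mul_sub_integral_le {a b K : ℝ} (ha : 0 ≤ a) (hab : a ≤ b)
    {c : ℕ → ℂ} {f f' H h : ℝ → ℂ} {Φ φ : ℝ → ℝ}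
    (hf : ∀ t ∈ Set.Icc a b, HasDerivAt f (f' t) t) (hf' : ContinuousOn f' (Set.Icc a b))
    (hH : ∀ t ∈ Set.Icc a b, HasDerivAt H (h t) t) (hh : ContinuousOn h (Set.Icc a b))
    (hΦ : ∀ t ∈ Set.Icc a b, HasDerivAt Φ (φ t) t) (hφ : ContinuousOn φ (Set.Icc a b))
    (hfφ : ∀ t ∈ Set.Icc a b, ‖f' t‖ ≤ φ t)
    (hK : ∀ t ∈ Set.Icc a b, ‖∑ n ∈ Icc 0 ⌊t⌋₊, c n - H t‖ ≤ K) :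
    ‖∑ n ∈ Ioc ⌊a⌋₊ ⌊b⌋₊, f n * c n - ∫ t in a..b, f t * h t‖ ≤
      K * (‖f a‖ + ‖f b‖ + (Φ b - Φ a)) := by
  have ha' : a ∈ Set.Icc a b := ⟨le_rfl, hab⟩
  have hb' : b ∈ Set.Icc a b := ⟨hab, le_rfl⟩
  have hK0 : 0 ≤ K := (norm_nonneg _).trans (hK a ha')
  have hderiv : Set.EqOn (deriv f) f' (Set.Icc a b) := fun t ht => (hf t ht).deriv
  have hfint : IntegrableOn f' (Set.Icc a b) := hf'.integrableOn_compact isCompact_Icc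
  have hfint' : IntegrableOn (deriv f) (Set.Icc a b) :=
    hfint.congr_fun hderiv.symm measurableSet_Icc
  have abel := sum_mul_eq_sub_sub_integral_mul c ha hab
    (fun t ht => (hf t ht).differentiableAt) hfint'
  rw [← intervalIntegral.integral_of_le hab] at abel
  have hu : Set.uIcc a b = Set.Icc a b := Set.uIcc_of_le hab
  have I0 : IntervalIntegrable (fun t => deriv f t * ∑ k ∈ Icc 0 ⌊t⌋₊, c k) volume a b :=
    (intervalIntegrable_iff_integrableOn_Icc_of_le hab).2 (integrableOn_mul_sum_Icc c ha hfint')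
  have Hcont : ContinuousOn H (Set.Icc a b) := fun t ht => (hH t ht).continuousAt.continuousWithinAt
  have I1 : IntervalIntegrable (fun t => f' t * H t) volume a b :=
    ContinuousOn.intervalIntegrable (by rw [hu]; exact hf'.mul Hcont)
  have parts := intervalIntegral.integral_mul_deriv_eq_deriv_mul (a := a) (b := b)
    (u := f) (v := H) (u' := f') (v' := h) (by rw [hu]; exact hf) (by rw [hu]; exact hH)
    (ContinuousOn.intervalIntegrable (by rwa [hu])) (ContinuousOn.intervalIntegrable (by rwa [hu]))
  -- Summation by parts on the sum and integration by parts on the integral have the same shape, so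
  -- only the discrepancy between partial sums and `H` survives.
  have key : ∑ n ∈ Ioc ⌊a⌋₊ ⌊b⌋₊, f n * c n - ∫ t in a..b, f t * h t =
      f b * (∑ n ∈ Icc 0 ⌊b⌋₊, c n - H b) - f a * (∑ n ∈ Icc 0 ⌊a⌋₊, c n - H a) -
      ∫ t in a..b, (deriv f t * ∑ k ∈ Icc 0 ⌊t⌋₊, c k - f' t * H t) := by
    rw [intervalIntegral.integral_sub I0 I1, abel, parts]; ring
  have hint : ‖∫ t in a..b, (deriv f t * ∑ k ∈ Icc 0 ⌊t⌋₊, c k - f' t * H t)‖ ≤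
      K * (Φ b - Φ a) := by
    have hφint : IntervalIntegrable φ volume a b := ContinuousOn.intervalIntegrable (by rwa [hu])
    rw [← intervalIntegral.integral_eq_sub_of_hasDerivAt (by rw [hu]; exact hΦ) hφint,
      ← intervalIntegral.integral_const_mul]
    refine intervalIntegral.norm_integral_le_of_norm_le hab (ae_of_all _ fun t ht => ?_)
      (hφint.const_mul K)
    have ht' : t ∈ Set.Icc a b := Set.Ioc_subset_Icc_self ht
    rw [hderiv ht', ← mul_sub, norm_mul, mul_comm]
    exact mul_le_mul (hK t ht') (hfφ t ht') (norm_nonneg _) hK0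
  rw [key]
  refine (norm_sub_le _ _).trans ?_
  have e1 : ‖f b * (∑ n ∈ Icc 0 ⌊b⌋₊, c n - H b)‖ ≤ K * ‖f b‖ := by
    rw [norm_mul, mul_comm]; exact mul_le_mul_of_nonneg_right (hK b hb') (norm_nonneg _)
  have e2 : ‖f a * (∑ n ∈ Icc 0 ⌊a⌋₊, c n - H a)‖ ≤ K * ‖f a‖ := by
    rw [norm_mul, mul_comm]; exact mul_le_mul_of_nonneg_right (hK a ha') (norm_nonneg _)
  linarith [norm_sub_le (f b * (∑ n ∈ Icc 0 ⌊b⌋₊, c n - H b))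
    (f a * (∑ n ∈ Icc 0 ⌊a⌋₊, c n - H a))]

/-! ### Imaginary powers and smooth sums over integers -/

/-- The imaginary power `t ^ (i ε)` of a positive real number. -/
noncomputable def unitPow (ε t : ℝ) : ℂ := Complex.exp (Complex.I * ((ε * Real.log t : ℝ) : ℂ))

@[simp] theorem norm_unitPow (ε t : ℝ) : ‖unitPow ε t‖ = 1 := Complex.norm_exp_I_mul_ofReal _

@[simp] theorem unitPow_one (ε : ℝ) : unitPow ε 1 = 1 := by simp [unitPow]

@[simp] theorem unitPow_zero (t : ℝ) : unitPow 0 t = 1 := by simp [unitPow]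

theorem unitPow_mul (ε : ℝ) {s t : ℝ} (hs : s ≠ 0) (ht : t ≠ 0) :
    unitPow ε (s * t) = unitPow ε s * unitPow ε t := by
  rw [unitPow, unitPow, unitPow, Real.log_mul hs ht, ← Complex.exp_add]
  push_cast; ring_nf

theorem norm_unitPow_sub_unitPow_le (ε s t : ℝ) :
    ‖unitPow ε s - unitPow ε t‖ ≤ |ε| * |Real.log s - Real.log t| := by
  have : unitPow ε s - unitPow ε t = unitPow ε t *
      (Complex.exp (Complex.I * ((ε * (Real.log s - Real.log t) : ℝ) : ℂ)) - 1) := by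
    rw [mul_sub, unitPow, unitPow, ← Complex.exp_add]
    push_cast; ring_nf
  rw [this, norm_mul, norm_unitPow, one_mul, ← abs_mul]
  exact Real.norm_exp_I_mul_ofReal_sub_one_le

theorem norm_unitPow_sub_one_le (ε t : ℝ) : ‖unitPow ε t - 1‖ ≤ |ε| * |Real.log t| := by
  simpa using norm_unitPow_sub_unitPow_le ε t 1

theorem norm_unitPow_sub_one_le_two (ε t : ℝ) : ‖unitPow ε t - 1‖ ≤ 2 := by
  have := norm_sub_le (unitPow ε t) 1
  simp only [norm_unitPow, norm_one] at this
  linarith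

theorem hasDerivAt_unitPow (ε : ℝ) {t : ℝ} (ht : t ≠ 0) :
    HasDerivAt (unitPow ε) (Complex.I * ε * unitPow ε t / t) t := by
  have h1 : HasDerivAt (fun t : ℝ => ((ε * Real.log t : ℝ) : ℂ)) ((ε * t⁻¹ : ℝ) : ℂ) t :=
    ((Real.hasDerivAt_log ht).const_mul ε).ofReal_comp
  refine HasDerivAt.congr_deriv (h1.const_mul Complex.I).cexp ?_
  rw [unitPow]; push_cast; field_simp

theorem continuousOn_unitPow (ε : ℝ) {s : Set ℝ} (hs : ∀ t ∈ s, t ≠ 0) :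
    ContinuousOn (unitPow ε) s :=
  fun t ht => (hasDerivAt_unitPow ε (hs t ht)).continuousAt.continuousWithinAt

theorem hasDerivAt_ofReal_log {t : ℝ} (ht : t ≠ 0) :
    HasDerivAt (fun t : ℝ => (Real.log t : ℂ)) (1 / t : ℂ) t := by
  simpa using (Real.hasDerivAt_log ht).ofReal_comp

theorem hasDerivAt_ofReal (t : ℝ) : HasDerivAt (fun t : ℝ => (t : ℂ)) 1 t := by
  simpa using (hasDerivAt_id t).ofReal_comp

theorem continuousOn_ofReal_log {s : Set ℝ} (hs : ∀ t ∈ s, t ≠ 0) :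
    ContinuousOn (fun t : ℝ => (Real.log t : ℂ)) s :=
  fun t ht => (hasDerivAt_ofReal_log (hs t ht)).continuousAt.continuousWithinAt

/-- The range includes n = 0, so the sum is ⌊t⌋ + 1, which exceeds t by at most 1. -/
theorem norm_sum_one_sub_le {t : ℝ} (ht : 0 ≤ t) :
    ‖∑ n ∈ Icc 0 ⌊t⌋₊, (fun _ : ℕ => (1 : ℂ)) n - (t : ℂ)‖ ≤ 1 := by
  have h : ∑ n ∈ Icc 0 ⌊t⌋₊, (fun _ : ℕ => (1 : ℂ)) n - (t : ℂ) =
      (((⌊t⌋₊ : ℝ) + 1 - t : ℝ) : ℂ) := by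
    simp
  rw [h, Complex.norm_real, Real.norm_eq_abs, abs_le]
  constructor <;> linarith [Nat.floor_le ht, Nat.lt_floor_add_one t]

/-- Partial sums of `n ^ (-1 + i ε)` against the corresponding integral. -/
theorem norm_sum_unitPow_div_sub_le {ε : ℝ} (hε : ε ≠ 0) (hε1 : |ε| ≤ 1) {m N : ℕ} (hm : 1 ≤ m)
    (hmN : m ≤ N) :
    ‖∑ n ∈ Ioc m N, unitPow ε n / n - (unitPow ε N - unitPow ε m) / (Complex.I * ε)‖ ≤ 4 / m := by
  have hm0 : (0 : ℝ) < m := by exact_mod_cast hm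
  have hmN' : (m : ℝ) ≤ N := by exact_mod_cast hmN
  have hN0 : (0 : ℝ) < N := hm0.trans_le hmN'
  have hpos : ∀ t ∈ Set.Icc (m : ℝ) N, t ≠ 0 := fun t ht => (hm0.trans_le ht.1).ne'
  have hposC : ∀ t ∈ Set.Icc (m : ℝ) N, (t : ℂ) ≠ 0 := fun t ht => by
    exact_mod_cast hpos t ht
  have hc : ContinuousOn (fun t : ℝ => (t : ℂ)) (Set.Icc (m : ℝ) N) := by fun_prop
  have hU := continuousOn_unitPow ε hpos
  have key := norm_sum_mul_sub_integral_le (a := m) (b := N) (K := 1) hm0.le hmN'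
    (c := fun _ => 1) (f := fun t => unitPow ε t / t)
    (f' := fun t => (Complex.I * ε * unitPow ε t / t * t - unitPow ε t * 1) / (t : ℂ) ^ 2)
    (H := fun t => (t : ℂ)) (h := fun _ => 1) (Φ := fun t => 2 * -t⁻¹)
    (φ := fun t => 2 * - -(t ^ 2)⁻¹)
    (fun t ht => (hasDerivAt_unitPow ε (hpos t ht)).div (hasDerivAt_ofReal t) (hposC t ht))
    (((((continuousOn_const.mul hU).div hc hposC).mul hc).sub (hU.mul continuousOn_const)).div
      (hc.pow 2) fun t ht => pow_ne_zero 2 (hposC t ht))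
    (fun t _ => hasDerivAt_ofReal t) continuousOn_const
    (fun t ht => ((hasDerivAt_inv (hpos t ht)).neg).const_mul 2)
    (continuousOn_const.mul (ContinuousOn.neg (ContinuousOn.neg
      ((continuousOn_id.pow 2).inv₀ fun t ht => pow_ne_zero 2 (hpos t ht)))))
    (fun t ht => by
      have ht0 := hm0.trans_le ht.1
      rw [div_mul_cancel₀ _ (hposC t ht), norm_div, norm_pow, Complex.norm_real,
        Real.norm_of_nonneg ht0.le, neg_neg, div_eq_mul_inv]
      gcongr
      refine (norm_sub_le _ _).trans ?_
      simp only [norm_mul, Complex.norm_I, norm_unitPow, norm_one, Complex.norm_real,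
        Real.norm_eq_abs]
      linarith)
    (fun t ht => norm_sum_one_sub_le (hm0.le.trans ht.1))
  have hint : ∫ t in (m : ℝ)..N, unitPow ε t / t * 1 =
      (unitPow ε N - unitPow ε m) / (Complex.I * ε) := by
    have hε' : (ε : ℂ) ≠ 0 := by exact_mod_cast hε
    rw [intervalIntegral.integral_eq_sub_of_hasDerivAt
      (f := fun t => unitPow ε t / (Complex.I * ε)), sub_div]
    · intro t ht
      rw [Set.uIcc_of_le hmN'] at ht
      refine ((hasDerivAt_unitPow ε (hpos t ht)).div_const (Complex.I * ε)).congr_deriv ?_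
      field_simp [Complex.I_ne_zero]
    · apply ContinuousOn.intervalIntegrable
      rw [Set.uIcc_of_le hmN']
      exact (hU.div hc hposC).mul continuousOn_const
  rw [hint] at key
  simp only [Nat.floor_natCast, mul_one, one_mul] at key
  refine key.trans ?_
  simp only [norm_div, norm_unitPow, Complex.ofReal_natCast, Complex.norm_natCast]
  have : (1 : ℝ) / N ≤ 1 / m := one_div_le_one_div_of_le hm0 hmN'
  have h1 : (0 : ℝ) ≤ 1 / N := by positivity
  have h2 : (0 : ℝ) ≤ 1 / m := by positivity
  rw [show (4 : ℝ) / m = 4 * (1 / m) by ring]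
  simp only [← one_div]
  linarith

/-- Partial sums of `log n * n ^ (-1 + i ε)` against the corresponding integral. -/
theorem norm_sum_unitPow_mul_log_div_sub_le {ε : ℝ} (hε : ε ≠ 0) (hε1 : |ε| ≤ 1) {N : ℕ}
    (hN : 1 ≤ N) :
    ‖∑ n ∈ Ioc 0 N, unitPow ε n * Real.log n / n -
      (unitPow ε N * Real.log N / (Complex.I * ε) -
        (unitPow ε N - 1) / (Complex.I * ε) ^ 2)‖ ≤ 4 := by
  have hN' : (1 : ℝ) ≤ N := by exact_mod_cast hN
  have hN0 : (0 : ℝ) < N := by linarith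
  have hpos : ∀ t ∈ Set.Icc (1 : ℝ) N, t ≠ 0 := fun t ht => by linarith [ht.1]
  have hposC : ∀ t ∈ Set.Icc (1 : ℝ) N, (t : ℂ) ≠ 0 := fun t ht => by
    exact_mod_cast hpos t ht
  have hc : ContinuousOn (fun t : ℝ => (t : ℂ)) (Set.Icc (1 : ℝ) N) := by fun_prop
  have hU := continuousOn_unitPow ε hpos
  have hL := continuousOn_ofReal_log hpos
  have hLr : ContinuousOn Real.log (Set.Icc (1 : ℝ) N) :=
    Real.continuousOn_log.mono fun t ht => hpos t ht
  -- `Φ` is a primitive of (2 log t + 1) / t², which dominates the derivative of t^{-1+iε} log t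
  -- when |ε| ≤ 1.
  have key := norm_sum_mul_sub_integral_le (a := 1) (b := N) (K := 1) zero_le_one hN'
    (c := fun _ => 1) (f := fun t => unitPow ε t * Real.log t / t)
    (f' := fun t => ((Complex.I * ε * unitPow ε t / t * Real.log t + unitPow ε t * (1 / t)) * t -
      unitPow ε t * Real.log t * 1) / (t : ℂ) ^ 2)
    (H := fun t => (t : ℂ)) (h := fun _ => 1) (Φ := fun t => -((2 * Real.log t + 3) / t))
    (φ := fun t => -((2 * t⁻¹ * t - (2 * Real.log t + 3) * 1) / t ^ 2))
    (fun t ht => ((hasDerivAt_unitPow ε (hpos t ht)).mul (hasDerivAt_ofReal_log (hpos t ht))).div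
      (hasDerivAt_ofReal t) (hposC t ht))
    (((((((continuousOn_const.mul hU).div hc hposC).mul hL).add
      (hU.mul (continuousOn_const.div hc hposC))).mul hc).sub
        ((hU.mul hL).mul continuousOn_const)).div
      (hc.pow 2) fun t ht => pow_ne_zero 2 (hposC t ht))
    (fun t _ => hasDerivAt_ofReal t) continuousOn_const
    (fun t ht => ((((Real.hasDerivAt_log (hpos t ht)).const_mul 2).add_const 3).div
      (hasDerivAt_id t) (hpos t ht)).neg)
    (ContinuousOn.neg (ContinuousOn.div ((((continuousOn_const.mul
      (continuousOn_id.inv₀ hpos)).mul continuousOn_id)).sub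
        (((continuousOn_const.mul hLr).add continuousOn_const).mul continuousOn_const))
      (continuousOn_id.pow 2) fun t ht => pow_ne_zero 2 (hpos t ht)))
    (fun t ht => by
      have ht0 : 0 < t := by linarith [ht.1]
      have hlog : 0 ≤ Real.log t := Real.log_nonneg ht.1
      have e : (Complex.I * ε * unitPow ε t / t * Real.log t + unitPow ε t * (1 / t)) * t -
          unitPow ε t * Real.log t * 1 =
          Complex.I * ε * unitPow ε t * Real.log t + unitPow ε t - unitPow ε t * Real.log t := by
        have := hposC t ht
        field_simp
      rw [e, norm_div, norm_pow, Complex.norm_real, Real.norm_of_nonneg ht0.le, ← neg_div]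
      gcongr
      rw [mul_assoc 2, inv_mul_cancel₀ ht0.ne']
      refine (norm_sub_le _ _).trans ((add_le_add_left (norm_add_le _ _) _).trans ?_)
      simp only [norm_mul, Complex.norm_I, norm_unitPow, Complex.norm_real,
        Real.norm_eq_abs, abs_of_nonneg hlog]
      nlinarith)
    (fun t ht => norm_sum_one_sub_le (zero_le_one.trans ht.1))
  have hint : ∫ t in (1 : ℝ)..N, unitPow ε t * Real.log t / t * 1 =
      unitPow ε N * Real.log N / (Complex.I * ε) - (unitPow ε N - 1) / (Complex.I * ε) ^ 2 := by
    have hε' : (ε : ℂ) ≠ 0 := by exact_mod_cast hε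
    rw [intervalIntegral.integral_eq_sub_of_hasDerivAt
      (f := fun t => unitPow ε t * Real.log t / (Complex.I * ε) -
        unitPow ε t / (Complex.I * ε) ^ 2)]
    · simp; ring
    · intro t ht
      rw [Set.uIcc_of_le hN'] at ht
      have := hposC t ht
      refine ((((hasDerivAt_unitPow ε (hpos t ht)).mul
        (hasDerivAt_ofReal_log (hpos t ht))).div_const (Complex.I * ε)).sub
          ((hasDerivAt_unitPow ε (hpos t ht)).div_const ((Complex.I * ε) ^ 2))).congr_deriv ?_
      field_simp [Complex.I_ne_zero]
      ring
    · apply ContinuousOn.intervalIntegrable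
      rw [Set.uIcc_of_le hN']
      exact ((hU.mul hL).div hc hposC).mul continuousOn_const
  rw [hint] at key
  have hsum : ∑ n ∈ Ioc 0 N, unitPow ε n * Real.log n / n =
      ∑ n ∈ Ioc 1 N, unitPow ε n * Real.log n / n := by
    refine (sum_subset (Ioc_subset_Ioc_left zero_le_one) fun n hn hn' => ?_).symm
    have : n = 1 := by simp only [mem_Ioc] at hn hn'; omega
    simp [this]
  rw [hsum]
  simp only [Nat.floor_natCast, Nat.floor_one, mul_one, one_mul] at key
  refine key.trans ?_
  simp only [norm_div, norm_mul, norm_unitPow, Complex.norm_real, Complex.ofReal_natCast,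
    Complex.norm_natCast, Real.log_one, norm_zero]
  have hl0 : 0 ≤ Real.log N := Real.log_nonneg hN'
  have hl1 : Real.log N ≤ N - 1 := Real.log_le_sub_one_of_pos hN0
  have h1 : Real.log N / N ≤ 1 := by rw [div_le_one hN0]; linarith
  have h2 : 0 ≤ (2 * Real.log N + 3) / N := by positivity
  rw [Real.norm_of_nonneg hl0]
  norm_num
  linarith

/-! ### Mertens' first theorem, plain and twisted -/

open ArithmeticFunction in
/-- Mertens' first theorem for the von Mangoldt function. -/
theorem abs_sum_vonMangoldt_div_sub_log_le {N : ℕ} (hN : 1 ≤ N) :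
    |∑ n ∈ Ioc 0 N, vonMangoldt n / n - Real.log N| ≤ Real.log 4 + 4 := by
  have hN0 : (0 : ℝ) < N := by exact_mod_cast hN
  have hψ : ∑ n ∈ Ioc 0 N, vonMangoldt n ≤ (Real.log 4 + 4) * N := by
    simpa [Chebyshev.psi] using Chebyshev.psi_le_const_mul_self (x := N) hN0.le
  have hlog : ∑ n ∈ Ioc 0 N, Real.log n = ∑ n ∈ Ioc 0 N, vonMangoldt n * ((N / n : ℕ) : ℝ) := by
    rw [← sum_Ioc_mul_zeta_eq_sum, vonMangoldt_mul_zeta]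
    rfl
  have hupper : ∑ n ∈ Ioc 0 N, Real.log n ≤ N * Real.log N := by
    have := sum_le_card_nsmul (Ioc 0 N) (fun n : ℕ => Real.log n) (Real.log N) fun n hn => by
      simp only [mem_Ioc] at hn
      exact Real.log_le_log (by exact_mod_cast hn.1) (by exact_mod_cast hn.2)
    simpa using this
  have hlower : N * Real.log N - N ≤ ∑ n ∈ Ioc 0 N, Real.log n := by
    have h1 : ∑ n ∈ Ioc 0 N, Real.log n = Real.log (N.factorial : ℝ) := by
      rw [← prod_Ico_id_eq_factorial, Nat.cast_prod, Real.log_prod]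
      · rfl
      · intro n hn
        simp only [mem_Ico] at hn
        exact_mod_cast (by omega : n ≠ 0)
    have h2 := Real.log_le_log (by positivity) (Real.pow_div_factorial_le_exp (N : ℝ) hN0.le N)
    rw [Real.log_div (by positivity) (by positivity), Real.log_pow, Real.log_exp] at h2
    linarith
  -- Replacing ⌊N/n⌋ by N/n costs at most Λ(n), in total ψ(N), which Chebyshev's bound makes O(N).
  have hfloor : ∀ n ∈ Ioc 0 N, vonMangoldt n * ((N / n : ℕ) : ℝ) ≤ N * (vonMangoldt n / n) ∧
      N * (vonMangoldt n / n) ≤ vonMangoldt n * ((N / n : ℕ) : ℝ) + vonMangoldt n := fun n hn => by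
    have hn0 : (0 : ℝ) < n := by exact_mod_cast (mem_Ioc.1 hn).1
    have e : (N : ℝ) * (vonMangoldt n / n) = vonMangoldt n * (N / n) := by ring
    rw [e]
    have h1 : ((N / n : ℕ) : ℝ) ≤ N / n := Nat.cast_div_le
    have h2 : (N : ℝ) / n ≤ ((N / n : ℕ) : ℝ) + 1 := by
      rw [← Nat.floor_div_eq_div (K := ℝ)]; exact (Nat.lt_floor_add_one _).le
    have := vonMangoldt_nonneg (n := n)
    constructor <;> nlinarith
  have s1 := sum_le_sum fun n hn => (hfloor n hn).1
  have s2 := sum_le_sum fun n hn => (hfloor n hn).2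
  rw [← mul_sum] at s1 s2
  rw [sum_add_distrib] at s2
  have : N * |∑ n ∈ Ioc 0 N, vonMangoldt n / n - Real.log N| ≤ N * (Real.log 4 + 4) := by
    rw [← abs_of_pos hN0, ← abs_mul, abs_of_pos hN0, abs_le]
    have := Real.log_nonneg (show (1 : ℝ) ≤ 4 by norm_num)
    constructor <;> nlinarith
  exact le_of_mul_le_mul_left this hN0

open ArithmeticFunction in
/-- The convolution identity `log = Λ * 1` twisted by `n ^ (-1 + i ε)` and summed. -/
theorem sum_unitPow_mul_log_div (ε : ℝ) (N : ℕ) :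
    ∑ n ∈ Ioc 0 N, unitPow ε n * Real.log n / n =
      ∑ d ∈ Ioc 0 N, vonMangoldt d * unitPow ε d / d *
        ∑ m ∈ Ioc 0 (N / d), unitPow ε m / m := by
  let f : ArithmeticFunction ℂ := ⟨fun n => vonMangoldt n * unitPow ε n / n, by simp⟩
  let g : ArithmeticFunction ℂ := ⟨fun n => unitPow ε n / n, by simp⟩
  have := sum_Ioc_mul_eq_sum_sum f g N
  refine Eq.trans (sum_congr rfl fun n hn => ?_) this
  rw [mul_apply]
  have hn0 : n ≠ 0 := (mem_Ioc.1 hn).1.ne'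
  have h1 : ∀ x ∈ n.divisorsAntidiagonal,
      f x.1 * g x.2 = (vonMangoldt x.1 : ℂ) * (unitPow ε n / n) := fun x hx => by
    have hx' := Nat.mem_divisorsAntidiagonal.1 hx
    have hx1 : x.1 ≠ 0 := fun h => by simp [h] at hx'; omega
    have hx2 : x.2 ≠ 0 := fun h => by simp [h] at hx'; omega
    have e : unitPow ε n = unitPow ε x.1 * unitPow ε x.2 := by
      rw [← hx'.1, Nat.cast_mul]
      exact unitPow_mul ε (by exact_mod_cast hx1) (by exact_mod_cast hx2)
    change (vonMangoldt x.1 : ℂ) * unitPow ε x.1 / x.1 * (unitPow ε x.2 / x.2) = _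
    rw [e, ← hx'.1]
    push_cast
    field_simp
  rw [sum_congr rfl h1, ← sum_mul, Nat.sum_divisorsAntidiagonal (fun d _ => (vonMangoldt d : ℂ)),
    ← Complex.ofReal_sum, vonMangoldt_sum]
  ring

open ArithmeticFunction in
/-- The partial sums of `Λ(n) n ^ (-1 + i ε)` are `O(1 / |ε|)` uniformly for small `ε ≠ 0`. -/
theorem norm_sum_vonMangoldt_mul_unitPow_div_le {ε : ℝ} (hε : ε ≠ 0) (hε1 : |ε| ≤ 1 / 16) {N : ℕ}
    (hN : 1 ≤ N) :
    ‖∑ n ∈ Ioc 0 N, vonMangoldt n * unitPow ε n / n‖ ≤ 1000 / |ε| := by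
  have hN0 : (0 : ℝ) < N := by exact_mod_cast hN
  have hε0 : 0 < |ε| := abs_pos.2 hε
  have hεC : (ε : ℂ) ≠ 0 := by exact_mod_cast hε
  have hlog4 : Real.log 4 ≤ 2 := by
    rw [show (4 : ℝ) = 2 ^ 2 by norm_num, Real.log_pow]
    have := Real.log_two_lt_d9
    push_cast; linarith
  have hψ : ∑ n ∈ Ioc 0 N, vonMangoldt n ≤ 6 * N := by
    have : ∑ n ∈ Ioc 0 N, vonMangoldt n ≤ (Real.log 4 + 4) * N := by
      simpa [Chebyshev.psi] using Chebyshev.psi_le_const_mul_self (x := N) hN0.le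
    nlinarith
  set Z : ℕ → ℂ := fun M => ∑ m ∈ Ioc 0 M, unitPow ε m / m with hZ
  set w : ℂ := Complex.I * ε with hw
  have hw0 : w ≠ 0 := mul_ne_zero Complex.I_ne_zero hεC
  have hwn : ‖w‖ = |ε| := by simp [hw]
  -- `r` approximates ζ(1 - iε), the constant term of `Z`. Defining it at the endpoint `N` avoids
  -- any limit.
  set r : ℂ := Z N - unitPow ε N / w with hr
  have hZr : ∀ m, 1 ≤ m → m ≤ N → ‖Z m - unitPow ε m / w - r‖ ≤ 4 / m := fun m h1 h2 => by
    have := norm_sum_unitPow_div_sub_le hε (hε1.trans (by norm_num)) h1 h2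
    rw [norm_sub_rev] at this
    refine (congrArg norm ?_).trans_le this
    have : Z N = Z m + ∑ n ∈ Ioc m N, unitPow ε n / n :=
      (sum_Ioc_consecutive _ (Nat.zero_le m) h2).symm
    rw [hr, this]; ring
  -- The expansion of `Z` at m = 1 gives r = -1/w + O(1) with the O(1) at most 5, and 1 / |ε| ≥ 16.
  have hrlow : 1 / (2 * |ε|) ≤ ‖r‖ := by
    have h1 := hZr 1 le_rfl hN
    have h2 : Z 1 = 1 := by simp [hZ]
    rw [h2] at h1
    simp only [Nat.cast_one, unitPow_one, div_one] at h1
    have h3 : ‖1 / w‖ ≤ ‖r‖ + 5 := by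
      have e : (1 : ℂ) / w = 1 - r - (1 - 1 / w - r) := by ring
      rw [e]
      refine (norm_sub_le _ _).trans ?_
      have := norm_sub_le 1 r
      rw [norm_one] at this
      linarith
    rw [norm_div, norm_one, hwn] at h3
    have h4 : 16 ≤ 1 / |ε| := by rw [le_div_iff₀ hε0]; linarith
    have h5 : 1 / (2 * |ε|) = 1 / |ε| / 2 := by field_simp
    rw [h5]; linarith
  -- The expansion is moved from ⌊N/d⌋ to N/d. Since ⌊N/d⌋ ≥ N/(2d), the errors 4 and 1 over ⌊N/d⌋
  -- add up to 10 d/N.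
  have hZd : ∀ d ∈ Ioc 0 N, ‖Z (N / d) - (unitPow ε N / unitPow ε d) / w - r‖ ≤
      10 * d / N := fun d hd => by
    obtain ⟨hd1, hd2⟩ := mem_Ioc.1 hd
    have hd0 : (0 : ℝ) < d := by exact_mod_cast hd1
    have hm1 : 1 ≤ N / d := Nat.div_pos hd2 hd1
    have hm0 : (0 : ℝ) < ((N / d : ℕ) : ℝ) := by exact_mod_cast hm1
    have h1 := hZr (N / d) hm1 (Nat.div_le_self N d)
    have hle : ((N / d : ℕ) : ℝ) ≤ N / d := Nat.cast_div_le
    have hlt : (N : ℝ) / d ≤ ((N / d : ℕ) : ℝ) + 1 := by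
      rw [← Nat.floor_div_eq_div (K := ℝ)]; exact (Nat.lt_floor_add_one _).le
    have hx0 : (0 : ℝ) < N / d := by positivity
    have hU : unitPow ε N / unitPow ε d = unitPow ε (N / d) := by
      rw [div_eq_iff (by rw [← norm_ne_zero_iff]; simp), ← unitPow_mul ε hx0.ne' hd0.ne']
      congr 1; field_simp
    have hdiff : ‖unitPow ε (N / d) / w - unitPow ε ((N / d : ℕ) : ℝ) / w‖ ≤
        1 / ((N / d : ℕ) : ℝ) := by
      rw [← sub_div, norm_div, hwn, div_le_iff₀ hε0, mul_comm (1 / _)]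
      refine (norm_unitPow_sub_unitPow_le _ _ _).trans (mul_le_mul_of_nonneg_left ?_ hε0.le)
      rw [← Real.log_div hx0.ne' hm0.ne', abs_of_nonneg (Real.log_nonneg (by
        rw [le_div_iff₀ hm0]; linarith))]
      refine (Real.log_le_sub_one_of_pos (by positivity)).trans ?_
      rw [sub_le_iff_le_add, div_le_iff₀ hm0, add_mul, one_div, inv_mul_cancel₀ hm0.ne']
      linarith
    have hinv : 1 / ((N / d : ℕ) : ℝ) ≤ 2 * d / N := by
      rw [div_le_div_iff₀ hm0 hN0]
      have : (1 : ℝ) ≤ ((N / d : ℕ) : ℝ) := by exact_mod_cast hm1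
      have h3 : (N : ℝ) / d ≤ 2 * ((N / d : ℕ) : ℝ) := by linarith
      rw [div_le_iff₀ hd0] at h3
      linarith
    have e : Z (N / d) - (unitPow ε N / unitPow ε d) / w - r =
        (Z (N / d) - unitPow ε ((N / d : ℕ) : ℝ) / w - r) -
          (unitPow ε (N / d) / w - unitPow ε ((N / d : ℕ) : ℝ) / w) := by rw [hU]; ring
    rw [e]
    refine (norm_sub_le _ _).trans ((add_le_add h1 hdiff).trans ?_)
    calc (4 : ℝ) / ((N / d : ℕ) : ℝ) + 1 / ((N / d : ℕ) : ℝ) = 5 * (1 / ((N / d : ℕ) : ℝ)) := by ring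
      _ ≤ 5 * (2 * d / N) := by linarith
      _ = 10 * d / N := by ring
  set S : ℂ := ∑ n ∈ Ioc 0 N, vonMangoldt n * unitPow ε n / n with hS
  set M : ℝ := ∑ n ∈ Ioc 0 N, vonMangoldt n / n with hM
  have hmain : ‖∑ d ∈ Ioc 0 N, vonMangoldt d * unitPow ε d / d * Z (N / d) -
      (unitPow ε N / w * M + r * S)‖ ≤ 60 := by
    have e : ∑ d ∈ Ioc 0 N, vonMangoldt d * unitPow ε d / d * Z (N / d) -
        (unitPow ε N / w * M + r * S) = ∑ d ∈ Ioc 0 N, vonMangoldt d * unitPow ε d / d *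
          (Z (N / d) - (unitPow ε N / unitPow ε d) / w - r) := by
      rw [hM, Complex.ofReal_sum, hS, mul_sum, mul_sum, ← sum_add_distrib, ← sum_sub_distrib]
      refine sum_congr rfl fun d hd => ?_
      have h0 : unitPow ε d ≠ 0 := by rw [← norm_ne_zero_iff]; simp
      push_cast
      field_simp
      ring
    rw [e]
    have h1 : ∀ d ∈ Ioc 0 N, ‖(vonMangoldt d : ℂ) * unitPow ε d / d *
        (Z (N / d) - (unitPow ε N / unitPow ε d) / w - r)‖ ≤ 10 / N * vonMangoldt d :=
      fun d hd => by
        have hd0 : (0 : ℝ) < d := by exact_mod_cast (mem_Ioc.1 hd).1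
        rw [norm_mul, norm_div, norm_mul, norm_unitPow, mul_one, Complex.norm_real,
          Real.norm_of_nonneg vonMangoldt_nonneg, Complex.norm_natCast]
        refine (mul_le_mul_of_nonneg_left (hZd d hd)
          (div_nonneg vonMangoldt_nonneg hd0.le)).trans (le_of_eq ?_)
        field_simp
    refine (norm_sum_le_of_le _ h1).trans ?_
    rw [← mul_sum, div_mul_eq_mul_div, div_le_iff₀ hN0]
    linarith
  rw [← sum_unitPow_mul_log_div] at hmain
  have hlogsum := norm_sum_unitPow_mul_log_div_sub_le hε (hε1.trans (by norm_num)) hN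
  set T : ℂ := ∑ n ∈ Ioc 0 N, unitPow ε n * Real.log n / n with hT
  have hMert := abs_sum_vonMangoldt_div_sub_log_le hN
  rw [← hM] at hMert
  -- Both sides of the convolution identity carry the main term N^{iε} log N / w. It cancels up to
  -- log N - M, which Mertens bounds.
  have hid : r * S = unitPow ε N / w * ((Real.log N - M : ℝ) : ℂ) - (unitPow ε N - 1) / w ^ 2 +
      (T - (unitPow ε N * Real.log N / w - (unitPow ε N - 1) / w ^ 2)) -
      (T - (unitPow ε N / w * M + r * S)) := by
    push_cast; ring
  have hb1 : ‖unitPow ε N / w * ((Real.log N - M : ℝ) : ℂ)‖ ≤ 6 / |ε| := by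
    rw [norm_mul, norm_div, norm_unitPow, hwn, Complex.norm_real, Real.norm_eq_abs, abs_sub_comm,
      div_mul_eq_mul_div, one_mul]
    gcongr
    linarith
  have hb2 : ‖(unitPow ε N - 1) / w ^ 2‖ ≤ 2 / |ε| ^ 2 := by
    rw [norm_div, norm_pow, hwn]
    gcongr
    exact norm_unitPow_sub_one_le_two _ _
  have hrS : ‖r‖ * ‖S‖ ≤ 6 / |ε| + 2 / |ε| ^ 2 + 64 := by
    rw [← norm_mul, hid]
    refine (norm_sub_le _ _).trans ?_
    refine (add_le_add ((norm_add_le _ _).trans (add_le_add (norm_sub_le _ _) le_rfl))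
      le_rfl).trans ?_
    linarith
  have hfin : 1 / (2 * |ε|) * ‖S‖ ≤ 6 / |ε| + 2 / |ε| ^ 2 + 64 :=
    (mul_le_mul_of_nonneg_right hrlow (norm_nonneg _)).trans hrS
  have h6 : ‖S‖ = 2 * |ε| * (1 / (2 * |ε|) * ‖S‖) := by field_simp
  rw [h6]
  refine (mul_le_mul_of_nonneg_left hfin (by positivity)).trans ?_
  rw [le_div_iff₀ hε0]
  have h7 : 2 * |ε| * (6 / |ε| + 2 / |ε| ^ 2 + 64) * |ε| = 12 * |ε| + 4 + 128 * |ε| ^ 2 := by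
    field_simp; ring
  rw [h7]
  nlinarith

/-- The sequence supported on the primes with `p ↦ log p * p ^ (-1 + i ε)`. -/
noncomputable def primeWeight (ε : ℝ) (n : ℕ) : ℂ :=
  if n.Prime then (Real.log n : ℂ) * unitPow ε n / n else 0

open ArithmeticFunction in
/-- Prime powers contribute a bounded amount to the twisted von Mangoldt sums. -/
theorem exists_norm_sum_vonMangoldt_sub_primeWeight_le :
    ∃ B : ℝ, 0 ≤ B ∧ ∀ (ε : ℝ) (N : ℕ),
      ‖∑ n ∈ Ioc 0 N, vonMangoldt n * unitPow ε n / n - ∑ n ∈ Ioc 0 N, primeWeight ε n‖ ≤ B := by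
  -- With modulus 1 the only residue class is everything, so this is the convergence of ∑ Λ(n)/n
  -- over non-primes.
  have hs := vonMangoldt.summable_residueClass_non_primes_div (q := 1) 0
  have hnn : ∀ n : ℕ, 0 ≤ (if n.Prime then 0 else vonMangoldt.residueClass (0 : ZMod 1) n) / n :=
    fun n => div_nonneg (by split_ifs <;> [rfl; exact vonMangoldt.residueClass_nonneg _ _])
      n.cast_nonneg
  refine ⟨∑' n : ℕ, (if n.Prime then 0 else vonMangoldt.residueClass (0 : ZMod 1) n) / n,
    tsum_nonneg hnn, fun ε N => ?_⟩
  rw [← sum_sub_distrib]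
  refine (norm_sum_le_of_le _ fun n hn => ?_).trans (hs.sum_le_tsum (Ioc 0 N) fun n _ => hnn n)
  rw [primeWeight]
  split_ifs with hp
  · simp [vonMangoldt_apply_prime hp]
  · have : vonMangoldt.residueClass (0 : ZMod 1) n = vonMangoldt n := by
      simp [vonMangoldt.residueClass, Subsingleton.elim (n : ZMod 1) 0]
    rw [this, sub_zero, norm_div, norm_mul, norm_unitPow, mul_one, Complex.norm_real,
      Real.norm_of_nonneg vonMangoldt_nonneg, Complex.norm_natCast]

theorem sum_Icc_primeWeight (ε : ℝ) (N : ℕ) :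
    ∑ n ∈ Icc 0 N, primeWeight ε n = ∑ n ∈ Ioc 0 N, primeWeight ε n := by
  rw [Icc_eq_cons_Ioc (Nat.zero_le _), sum_cons]
  simp [primeWeight, Nat.not_prime_zero]

/-- Mertens' first theorem, and its twisted form. -/
theorem exists_norm_sum_primeWeight_le :
    ∃ K : ℝ, 0 < K ∧
      (∀ t : ℝ, 1 ≤ t → ‖∑ n ∈ Icc 0 ⌊t⌋₊, primeWeight 0 n - Real.log t‖ ≤ K) ∧
      ∀ ε : ℝ, ε ≠ 0 → |ε| ≤ 1 / 16 → ∀ t : ℝ, 1 ≤ t →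
        ‖∑ n ∈ Icc 0 ⌊t⌋₊, primeWeight ε n‖ ≤ K / |ε| := by
  obtain ⟨B, hB0, hB⟩ := exists_norm_sum_vonMangoldt_sub_primeWeight_le
  have hlog4 : 0 ≤ Real.log 4 := Real.log_nonneg (by norm_num)
  refine ⟨B + Real.log 4 + 1000, by positivity, fun t ht => ?_, fun ε hε hε1 t ht => ?_⟩
  · have hN : 1 ≤ ⌊t⌋₊ := (Nat.one_le_floor_iff t).2 ht
    have hN0 : (1 : ℝ) ≤ ⌊t⌋₊ := by exact_mod_cast hN
    have h1 := hB 0 ⌊t⌋₊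
    have h2 := abs_sum_vonMangoldt_div_sub_log_le hN
    rw [sum_Icc_primeWeight]
    have h3 : |Real.log ⌊t⌋₊ - Real.log t| ≤ 1 := by
      rw [abs_sub_comm, ← Real.log_div (by linarith) (by linarith), abs_of_nonneg
        (Real.log_nonneg (by
          have := Nat.floor_le (zero_le_one.trans ht)
          rw [le_div_iff₀ (by linarith)]
          linarith))]
      refine (Real.log_le_sub_one_of_pos (by positivity)).trans ?_
      rw [sub_le_iff_le_add, div_le_iff₀ (by linarith)]
      linarith [Nat.lt_floor_add_one t]
    set P := ∑ n ∈ Ioc 0 ⌊t⌋₊, primeWeight 0 n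
    have e : P - Real.log t =
        ((∑ n ∈ Ioc 0 ⌊t⌋₊, ArithmeticFunction.vonMangoldt n / n - Real.log ⌊t⌋₊ : ℝ) : ℂ) +
        ((Real.log ⌊t⌋₊ - Real.log t : ℝ) : ℂ) -
        (∑ n ∈ Ioc 0 ⌊t⌋₊, (ArithmeticFunction.vonMangoldt n : ℂ) * unitPow 0 n / n - P) := by
      simp only [unitPow_zero]
      push_cast
      simp only [mul_one]
      ring
    rw [e]
    refine (norm_sub_le _ _).trans ((add_le_add (norm_add_le _ _) le_rfl).trans ?_)
    rw [Complex.norm_real, Complex.norm_real, Real.norm_eq_abs, Real.norm_eq_abs]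
    linarith
  · have hN : 1 ≤ ⌊t⌋₊ := (Nat.one_le_floor_iff t).2 ht
    have h1 := hB ε ⌊t⌋₊
    have h2 := norm_sum_vonMangoldt_mul_unitPow_div_le hε hε1 hN
    have hε0 : 0 < |ε| := abs_pos.2 hε
    rw [sum_Icc_primeWeight]
    have h3 := norm_le_norm_add_norm_sub
      (∑ n ∈ Ioc 0 ⌊t⌋₊, (ArithmeticFunction.vonMangoldt n : ℂ) * unitPow ε n / n)
      (∑ n ∈ Ioc 0 ⌊t⌋₊, primeWeight ε n)
    rw [add_assoc, add_div]
    have h4 : B ≤ B / |ε| := by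
      rw [le_div_iff₀ hε0]; nlinarith
    have h5 : 1000 / |ε| ≤ (Real.log 4 + 1000) / |ε| := by gcongr; linarith
    linarith

/-! ### The prime sum against its integral -/

/-- The sequence supported on the primes with `p ↦ (p ^ (i ε) - 1) / p`. -/
noncomputable def primeTerm (ε : ℝ) (n : ℕ) : ℂ := if n.Prime then (unitPow ε n - 1) / n else 0

/-- The continuous analogue of `primeTerm`, weighted by the prime density. -/
noncomputable def primeDensity (ε t : ℝ) : ℂ := (unitPow ε t - 1) / (t * Real.log t)

theorem continuousOn_primeDensity (ε : ℝ) {a b : ℝ} (ha : 1 < a) :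
    ContinuousOn (primeDensity ε) (Set.Icc a b) := by
  have hpos : ∀ t ∈ Set.Icc a b, t ≠ 0 := fun t ht => by linarith [ht.1]
  refine ((continuousOn_unitPow ε hpos).sub continuousOn_const).div
    ((Complex.continuous_ofReal.continuousOn).mul (continuousOn_ofReal_log hpos)) fun t ht => ?_
  have h := Real.log_pos (ha.trans_le ht.1)
  exact mul_ne_zero (by exact_mod_cast hpos t ht) (by exact_mod_cast h.ne')

theorem intervalIntegrable_primeDensity (ε : ℝ) {a b : ℝ} (ha : 1 < a) (hab : a ≤ b) :
    IntervalIntegrable (primeDensity ε) volume a b := by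
  apply ContinuousOn.intervalIntegrable
  rw [Set.uIcc_of_le hab]
  exact continuousOn_primeDensity ε ha

/-- Comparison of prime sums with integrals using Mertens' first theorem. -/
theorem norm_sum_primeTerm_sub_integral_le {K : ℝ}
    (hK : ∀ t : ℝ, 1 ≤ t → ‖∑ n ∈ Icc 0 ⌊t⌋₊, primeWeight 0 n - Real.log t‖ ≤ K)
    (ε : ℝ) {b : ℝ} (hb : 2 ≤ b) :
    ‖∑ n ∈ Ioc 2 ⌊b⌋₊, primeTerm ε n - ∫ t in (2 : ℝ)..b, primeDensity ε t‖ ≤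
      K * (|ε| + 2 / Real.log b +
        2 * |ε| * (Real.log (Real.log b) - Real.log (Real.log 2))) := by
  have hK0 : 0 ≤ K := (norm_nonneg _).trans (hK 1 le_rfl)
  have hpos : ∀ t ∈ Set.Icc 2 b, t ≠ 0 := fun t ht => by linarith [ht.1]
  have hposC : ∀ t ∈ Set.Icc 2 b, (t : ℂ) ≠ 0 := fun t ht => by exact_mod_cast hpos t ht
  have hlog : ∀ t ∈ Set.Icc 2 b, 0 < Real.log t := fun t ht => Real.log_pos (by linarith [ht.1])
  have hlogC : ∀ t ∈ Set.Icc 2 b, (Real.log t : ℂ) ≠ 0 := fun t ht => by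
    exact_mod_cast (hlog t ht).ne'
  have hc : ContinuousOn (fun t : ℝ => (t : ℂ)) (Set.Icc 2 b) := by fun_prop
  have hU := continuousOn_unitPow ε hpos
  have hL := continuousOn_ofReal_log hpos
  have hLr : ContinuousOn Real.log (Set.Icc 2 b) :=
    Real.continuousOn_log.mono fun t ht => hpos t ht
  -- Each of the two terms of `f'` is at most |ε| / (t log t) because |t^{iε} - 1| ≤ |ε| log t;
  -- hence the double logarithm in `Φ`.
  have key := norm_sum_mul_sub_integral_le (a := 2) (b := b) (K := K) zero_le_two hb
    (c := primeWeight 0) (f := fun t => (unitPow ε t - 1) / Real.log t)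
    (f' := fun t => (Complex.I * ε * unitPow ε t / t * Real.log t -
      (unitPow ε t - 1) * (1 / t)) / (Real.log t : ℂ) ^ 2)
    (H := fun t => (Real.log t : ℂ)) (h := fun t => 1 / (t : ℂ))
    (Φ := fun t => 2 * |ε| * Real.log (Real.log t))
    (φ := fun t => 2 * |ε| * (t⁻¹ / Real.log t))
    (fun t ht => ((hasDerivAt_unitPow ε (hpos t ht)).sub_const 1).div
      (hasDerivAt_ofReal_log (hpos t ht)) (hlogC t ht))
    ((((((continuousOn_const.mul hU).div hc hposC).mul hL).sub
      ((hU.sub continuousOn_const).mul (continuousOn_const.div hc hposC)))).div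
      (hL.pow 2) fun t ht => pow_ne_zero 2 (hlogC t ht))
    (fun t ht => hasDerivAt_ofReal_log (hpos t ht)) (continuousOn_const.div hc hposC)
    (fun t ht => ((Real.hasDerivAt_log (hpos t ht)).log (hlog t ht).ne').const_mul _)
    (continuousOn_const.mul ((continuousOn_id.inv₀ hpos).div hLr fun t ht => (hlog t ht).ne'))
    (fun t ht => by
      have ht0 : 0 < t := by linarith [ht.1]
      have hl := hlog t ht
      rw [norm_div, norm_pow, Complex.norm_real, Real.norm_of_nonneg hl.le,
        div_le_iff₀ (by positivity)]
      refine (norm_sub_le _ _).trans ?_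
      have h1 := norm_unitPow_sub_one_le ε t
      rw [abs_of_pos hl] at h1
      simp only [norm_mul, norm_div, Complex.norm_I, norm_unitPow, norm_one, Complex.norm_real,
        Real.norm_eq_abs, abs_of_pos ht0, abs_of_pos hl, one_mul, mul_one]
      calc |ε| / t * Real.log t + ‖unitPow ε t - 1‖ * (1 / t)
          ≤ |ε| / t * Real.log t + |ε| * Real.log t * (1 / t) := by gcongr
        _ = 2 * |ε| * (t⁻¹ / Real.log t) * Real.log t ^ 2 := by field_simp; ring)
    (fun t ht => hK t (by linarith [ht.1]))
  have hsum : ∑ n ∈ Ioc 2 ⌊b⌋₊, primeTerm ε n =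
      ∑ n ∈ Ioc ⌊(2 : ℝ)⌋₊ ⌊b⌋₊, (unitPow ε n - 1) / Real.log n * primeWeight 0 n := by
    rw [Nat.floor_ofNat]
    refine sum_congr rfl fun n hn => ?_
    have hn2 : 2 < n := (mem_Ioc.1 hn).1
    have hn1 : (1 : ℝ) < n := by exact_mod_cast (by omega : 1 < n)
    have hl : (Real.log n : ℂ) ≠ 0 := by exact_mod_cast (Real.log_pos hn1).ne'
    rw [primeTerm, primeWeight]
    split_ifs
    · rw [unitPow_zero]; field_simp
    · simp
  have hint : ∫ t in (2 : ℝ)..b, primeDensity ε t =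
      ∫ t in (2 : ℝ)..b, (unitPow ε t - 1) / Real.log t * (1 / t) := by
    congr 1; ext t
    rw [primeDensity, div_mul_div_comm, mul_one, mul_comm (t : ℂ)]
  rw [hsum, hint]
  refine key.trans (mul_le_mul_of_nonneg_left ?_ hK0)
  have hl2 := hlog 2 ⟨le_rfl, hb⟩
  have hlb := hlog b ⟨hb, le_rfl⟩
  have e1 : ‖(unitPow ε 2 - 1) / Real.log 2‖ ≤ |ε| := by
    rw [norm_div, Complex.norm_real, Real.norm_of_nonneg hl2.le, div_le_iff₀ hl2]
    simpa [abs_of_pos hl2] using norm_unitPow_sub_one_le ε 2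
  have e2 : ‖(unitPow ε b - 1) / Real.log b‖ ≤ 2 / Real.log b := by
    rw [norm_div, Complex.norm_real, Real.norm_of_nonneg hlb.le]
    gcongr
    exact norm_unitPow_sub_one_le_two _ _
  linarith

/-- Comparison of prime sums with integrals far out, using the twisted Mertens theorem. -/
theorem norm_sum_primeTerm_sub_integral_le_of_twisted {K ε : ℝ} (hε : ε ≠ 0)
    (hK : ∀ t : ℝ, 1 ≤ t → ‖∑ n ∈ Icc 0 ⌊t⌋₊, primeWeight 0 n - Real.log t‖ ≤ K)
    (hKε : ∀ t : ℝ, 1 ≤ t → ‖∑ n ∈ Icc 0 ⌊t⌋₊, primeWeight ε n‖ ≤ K / |ε|)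
    {y b : ℝ} (hy : 2 ≤ y) (hyb : y ≤ b) :
    ‖∑ n ∈ Ioc ⌊y⌋₊ ⌊b⌋₊, primeTerm ε n - ∫ t in y..b, primeDensity ε t‖ ≤
      (K / |ε| + K + 1 / |ε|) * (2 / Real.log y) := by
  have hpos : ∀ t ∈ Set.Icc y b, t ≠ 0 := fun t ht => by linarith [ht.1]
  have hposC : ∀ t ∈ Set.Icc y b, (t : ℂ) ≠ 0 := fun t ht => by exact_mod_cast hpos t ht
  have hlog : ∀ t ∈ Set.Icc y b, 0 < Real.log t := fun t ht => Real.log_pos (by linarith [ht.1])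
  have hlogC : ∀ t ∈ Set.Icc y b, (Real.log t : ℂ) ≠ 0 := fun t ht => by
    exact_mod_cast (hlog t ht).ne'
  have hεC : (ε : ℂ) ≠ 0 := by exact_mod_cast hε
  have hc : ContinuousOn (fun t : ℝ => (t : ℂ)) (Set.Icc y b) := by fun_prop
  have hU := continuousOn_unitPow ε hpos
  have hL := continuousOn_ofReal_log hpos
  have hLr : ContinuousOn Real.log (Set.Icc y b) :=
    Real.continuousOn_log.mono fun t ht => hpos t ht
  -- The term t^{iε} / (iε) of `H` is no sharper an approximation than 0: it is bounded by 1 / |ε|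
  -- like the twisted sum itself, and is included so that `f * h` is exactly the density.
  have key := norm_sum_mul_sub_integral_le (a := y) (b := b) (K := K / |ε| + K + 1 / |ε|)
    (by linarith) hyb
    (c := fun n => primeWeight ε n - primeWeight 0 n) (f := fun t => ((Real.log t : ℂ))⁻¹)
    (f' := fun t => -(1 / (t : ℂ)) / (Real.log t : ℂ) ^ 2)
    (H := fun t => unitPow ε t / (Complex.I * ε) - (Real.log t : ℂ))
    (h := fun t => Complex.I * ε * unitPow ε t / t / (Complex.I * ε) - 1 / (t : ℂ))
    (Φ := fun t => -(Real.log t)⁻¹)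
    (φ := fun t => -(-t⁻¹ / Real.log t ^ 2))
    (fun t ht => (hasDerivAt_ofReal_log (hpos t ht)).fun_inv (hlogC t ht))
    ((continuousOn_const.div hc hposC).neg.div (hL.pow 2) fun t ht => pow_ne_zero 2 (hlogC t ht))
    (fun t ht => ((hasDerivAt_unitPow ε (hpos t ht)).div_const _).sub
      (hasDerivAt_ofReal_log (hpos t ht)))
    ((((continuousOn_const.mul hU).div hc hposC).div_const _).sub
      (continuousOn_const.div hc hposC))
    (fun t ht => ((Real.hasDerivAt_log (hpos t ht)).fun_inv (hlog t ht).ne').neg)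
    (((continuousOn_id.inv₀ hpos).neg.div (hLr.pow 2)
      fun t ht => pow_ne_zero 2 (hlog t ht).ne').neg)
    (fun t ht => by
      have ht0 : 0 < t := by linarith [ht.1]
      have hl := hlog t ht
      rw [norm_div, norm_neg, norm_div, norm_one, norm_pow, Complex.norm_real, Complex.norm_real,
        Real.norm_of_nonneg hl.le, Real.norm_of_nonneg ht0.le, neg_div, neg_neg, one_div])
    (fun t ht => by
      have ht1 : 1 ≤ t := by linarith [ht.1]
      rw [sum_sub_distrib]
      have e : ∑ n ∈ Icc 0 ⌊t⌋₊, primeWeight ε n - ∑ n ∈ Icc 0 ⌊t⌋₊, primeWeight 0 n -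
          (unitPow ε t / (Complex.I * ε) - (Real.log t : ℂ)) =
          ∑ n ∈ Icc 0 ⌊t⌋₊, primeWeight ε n -
            (∑ n ∈ Icc 0 ⌊t⌋₊, primeWeight 0 n - Real.log t) - unitPow ε t / (Complex.I * ε) := by
        ring
      rw [e]
      refine (norm_sub_le _ _).trans (add_le_add ((norm_sub_le _ _).trans
        (add_le_add (hKε t ht1) (hK t ht1))) (le_of_eq ?_))
      simp)
  have hsum : ∑ n ∈ Ioc ⌊y⌋₊ ⌊b⌋₊, primeTerm ε n =
      ∑ n ∈ Ioc ⌊y⌋₊ ⌊b⌋₊, ((Real.log n : ℂ))⁻¹ * (primeWeight ε n - primeWeight 0 n) := by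
    refine sum_congr rfl fun n hn => ?_
    have hn1 : (1 : ℝ) < n := by linarith [(Nat.floor_lt (by linarith)).1 (mem_Ioc.1 hn).1]
    have hl : (Real.log n : ℂ) ≠ 0 := by exact_mod_cast (Real.log_pos hn1).ne'
    rw [primeTerm, primeWeight, primeWeight]
    split_ifs
    · rw [unitPow_zero]; field_simp
    · simp
  have hint : ∫ t in y..b, primeDensity ε t =
      ∫ t in y..b, ((Real.log t : ℂ))⁻¹ *
        (Complex.I * ε * unitPow ε t / t / (Complex.I * ε) - 1 / (t : ℂ)) := by
    refine intervalIntegral.integral_congr fun t ht => ?_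
    rw [Set.uIcc_of_le hyb] at ht
    have h1 := hposC t ht
    have h2 := hlogC t ht
    simp only [primeDensity]
    field_simp [Complex.I_ne_zero]
  rw [hsum, hint]
  refine key.trans (le_of_eq ?_)
  have hly := hlog y ⟨le_rfl, hyb⟩
  have hlb := hlog b ⟨hyb, le_rfl⟩
  simp only [norm_inv, Complex.norm_real, Real.norm_of_nonneg hly.le, Real.norm_of_nonneg hlb.le]
  ring

/-- Because 1/16 < 1/e; this lets every O(ε) be absorbed into |ε log |ε||. -/
theorem one_le_abs_log_abs {ε : ℝ} (hε : ε ≠ 0) (hε1 : |ε| ≤ 1 / 16) : 1 ≤ |Real.log (|ε|)| := by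
  have hε0 : 0 < |ε| := abs_pos.2 hε
  have h : Real.log |ε| ≤ -1 := by
    rw [Real.log_le_iff_le_exp hε0, Real.exp_neg]
    have := Real.exp_one_lt_d9
    refine hε1.trans ?_
    rw [le_inv_comm₀ (by norm_num) (Real.exp_pos _)]
    linarith
  rw [abs_of_nonpos (by linarith)]
  linarith

/-- The prime sum `∑_{p ≤ N} (p ^ (i ε) - 1) / p` compared with its integral analogue. -/
theorem exists_norm_sum_primeTerm_sub_integral_le :
    ∃ C : ℝ, 0 ≤ C ∧ ∀ ε : ℝ, ε ≠ 0 → |ε| ≤ 1 / 16 → ∀ N : ℕ, 2 ≤ N →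
      ‖∑ n ∈ Ioc 0 N, primeTerm ε n - ∫ t in (2 : ℝ)..N, primeDensity ε t‖ ≤
        C * (1 / Real.log N + |ε| * |Real.log (|ε|)|) := by
  obtain ⟨K, hK0, hK, hKt⟩ := exists_norm_sum_primeWeight_le
  refine ⟨15 * K + 3, by positivity, fun ε hε hε1 N hN => ?_⟩
  have hN' : (2 : ℝ) ≤ N := by exact_mod_cast hN
  have hlN : 0 < Real.log N := Real.log_pos (by linarith)
  have hε0 : 0 < |ε| := abs_pos.2 hε
  have hL1 := one_le_abs_log_abs hε hε1
  set L := |Real.log (|ε|)|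
  have hl2 : 1 / 2 ≤ Real.log 2 := by linarith [Real.log_two_gt_d9]
  have hll2 : -1 ≤ Real.log (Real.log 2) := by
    have h1 := Real.one_sub_inv_le_log_of_pos (show 0 < Real.log 2 by linarith)
    have h2 : (Real.log 2)⁻¹ ≤ 2 := by
      rw [inv_le_comm₀ (by linarith) (by norm_num)]; linarith
    linarith
  have hεL : |ε| ≤ |ε| * L := le_mul_of_one_le_right hε0.le hL1
  -- Abel summation from 2 runs over n > 2, so the prime 2 is estimated separately.
  have htwo : ‖∑ n ∈ Ioc 0 2, primeTerm ε n‖ ≤ |ε| := by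
    have : ∑ n ∈ Ioc 0 2, primeTerm ε n = (unitPow ε 2 - 1) / 2 := by
      rw [show Ioc 0 2 = {1, 2} by rfl, sum_pair (by norm_num)]
      simp [primeTerm, Nat.prime_two, Nat.not_prime_one]
    rw [this, norm_div]
    have h1 := norm_unitPow_sub_one_le ε 2
    rw [abs_of_pos (by linarith : 0 < Real.log 2)] at h1
    have h2 := Real.log_two_lt_d9
    rw [show ‖(2 : ℂ)‖ = 2 by simp]
    rw [div_le_iff₀ zero_lt_two]
    nlinarith
  -- In this range log log b ≤ 2L and -log log 2 ≤ 1 ≤ L; the 7 is 1 + 2 · 3.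
  have near : ∀ b : ℝ, 2 ≤ b → Real.log b ≤ (|ε| ^ 2)⁻¹ →
      ‖∑ n ∈ Ioc 2 ⌊b⌋₊, primeTerm ε n - ∫ t in (2 : ℝ)..b, primeDensity ε t‖ ≤
        K * (2 / Real.log b + 7 * (|ε| * L)) := fun b hb hlb => by
    refine (norm_sum_primeTerm_sub_integral_le hK ε hb).trans
      (mul_le_mul_of_nonneg_left ?_ hK0.le)
    have hlb0 : 0 < Real.log b := Real.log_pos (by linarith)
    have h1 := Real.log_le_log hlb0 hlb
    rw [Real.log_inv, Real.log_pow] at h1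
    have h2 : -Real.log |ε| ≤ L := neg_le_abs _
    push_cast at h1
    have h3 : 2 * |ε| * (Real.log (Real.log b) - Real.log (Real.log 2)) ≤
        2 * |ε| * (2 * L + L) := by
      gcongr
      linarith
    nlinarith
  have split : ∀ M, 2 ≤ M → ∑ n ∈ Ioc 0 M, primeTerm ε n =
      ∑ n ∈ Ioc 0 2, primeTerm ε n + ∑ n ∈ Ioc 2 M, primeTerm ε n := fun M hM =>
    (sum_Ioc_consecutive _ (Nat.zero_le 2) hM).symm
  have hinvN : 0 < 1 / Real.log N := by positivity
  rcases le_total (Real.log N) (|ε| ^ 2)⁻¹ with h | h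
  · have h1 := near N hN' h
    rw [Nat.floor_natCast] at h1
    rw [split N hN, add_sub_assoc]
    refine (norm_add_le _ _).trans ((add_le_add htwo h1).trans ?_)
    rw [show (2 : ℝ) / Real.log N = 2 * (1 / Real.log N) by ring]
    have : 0 ≤ K * (1 / Real.log N) := by positivity
    have : 0 ≤ K * (|ε| * L) := by positivity
    nlinarith
  -- This cut keeps log log y = 2 |log |ε|| while making (1 / |ε|) / log y equal to |ε|.
  · set y := Real.exp (|ε| ^ 2)⁻¹ with hy
    have hly : Real.log y = (|ε| ^ 2)⁻¹ := Real.log_exp _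
    have hy2 : 2 ≤ y := by
      have h1 : 1 ≤ (|ε| ^ 2)⁻¹ := by
        rw [one_le_inv₀ (by positivity)]; nlinarith
      linarith [Real.add_one_le_exp (|ε| ^ 2)⁻¹]
    have hyN : y ≤ N := by
      rwa [hy, ← Real.le_log_iff_exp_le (by linarith)]
    have h1 := near y hy2 hly.le
    have h2 := norm_sum_primeTerm_sub_integral_le_of_twisted hε hK (hKt ε hε hε1) hy2 hyN
    rw [hly, div_inv_eq_mul] at h1 h2
    rw [Nat.floor_natCast] at h2
    have hf2 : 2 ≤ ⌊y⌋₊ := Nat.le_floor (by exact_mod_cast hy2)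
    have hfN : ⌊y⌋₊ ≤ N := by simpa using Nat.floor_le_floor hyN
    rw [split N hN, ← sum_Ioc_consecutive _ hf2 hfN,
      ← intervalIntegral.integral_add_adjacent_intervals
        (intervalIntegrable_primeDensity ε one_lt_two hy2)
        (intervalIntegrable_primeDensity ε (by linarith) hyN)]
    have e : ∀ a b c d f : ℂ, a + (b + c) - (d + f) = a + (b - d) + (c - f) := by intros; ring
    rw [e]
    refine (norm_add_le _ _).trans ((add_le_add ((norm_add_le _ _).trans
      (add_le_add htwo h1)) h2).trans ?_)
    have h3 : (K / |ε| + K + 1 / |ε|) * (2 * |ε| ^ 2) = 2 * K * |ε| + 2 * K * |ε| ^ 2 + 2 * |ε| := by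
      field_simp
    have h4 : |ε| ^ 2 ≤ |ε| * L := by nlinarith
    rw [h3]
    have h5 := mul_le_mul_of_nonneg_left h4 hK0.le
    have h6 := mul_le_mul_of_nonneg_left hεL hK0.le
    have : 0 ≤ K * (1 / Real.log N) := by positivity
    nlinarith

/-- The substitution `t = N ^ v` in the exponent of `limitCharFn`. -/
theorem norm_integral_sub_integral_primeDensity_le (ε : ℝ) {N : ℕ} (hN : 2 ≤ N) :
    ‖(∫ v in (0 : ℝ)..1, (Complex.exp (Complex.I * ((ε * Real.log N : ℝ) : ℂ) * (v : ℂ)) - 1) /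
      (v : ℂ)) - ∫ t in (2 : ℝ)..N, primeDensity ε t‖ ≤ |ε| := by
  have hN' : (2 : ℝ) ≤ N := by exact_mod_cast hN
  have hlN : 0 < Real.log N := Real.log_pos (by linarith)
  have hl2 : 0 < Real.log 2 := Real.log_pos one_lt_two
  set lam := ε * Real.log N with hlam
  set g : ℝ → ℂ := fun v => (Complex.exp (Complex.I * (lam : ℂ) * (v : ℂ)) - 1) / (v : ℂ) with hg
  set v₂ := Real.log 2 / Real.log N with hv
  have hv0 : 0 < v₂ := by positivity
  have hv1 : v₂ ≤ 1 := by
    rw [hv, div_le_one hlN]; exact Real.log_le_log two_pos hN'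
  -- At v = 0 division by zero gives the value 0. The bound makes the piece over [0, v₂] at most
  -- |lam| v₂ = |ε| log 2.
  have hbound : ∀ v : ℝ, ‖g v‖ ≤ |lam| := fun v => by
    rcases eq_or_ne v 0 with rfl | h0
    · simp [hg]
    · rw [hg]
      simp only [norm_div, Complex.norm_real, Real.norm_eq_abs]
      rw [div_le_iff₀ (abs_pos.2 h0), ← abs_mul, mul_assoc, ← Complex.ofReal_mul]
      exact Real.norm_exp_I_mul_ofReal_sub_one_le
  have hmeas : Measurable g := by
    rw [hg]; fun_prop
  have hii : ∀ a b : ℝ, IntervalIntegrable g volume a b := fun a b =>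
    (intervalIntegrable_const (c := |lam|)).mono_fun hmeas.aestronglyMeasurable
      (ae_of_all _ fun v => by simpa using hbound v)
  rw [← intervalIntegral.integral_add_adjacent_intervals (hii 0 v₂) (hii v₂ 1)]
  have hpos : ∀ t ∈ Set.uIcc 2 (N : ℝ), 0 < t := fun t ht => by
    rw [Set.uIcc_of_le hN'] at ht; linarith [ht.1]
  have hsub := intervalIntegral.integral_deriv_smul_comp'' (a := 2) (b := (N : ℝ))
    (f := fun t => Real.log t / Real.log N) (f' := fun t => t⁻¹ / Real.log N) (g := g)
    ((Real.continuousOn_log.mono fun t ht => (hpos t ht).ne').div_const _)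
    (fun t ht => ((Real.hasDerivAt_log (hpos t (Set.mem_Icc_of_Ioo ht)).ne').div_const
      _).hasDerivWithinAt)
    ((continuousOn_id.inv₀ fun t ht => (hpos t ht).ne').div_const _)
    (by
      refine ContinuousOn.div (by fun_prop) (by fun_prop) ?_
      rintro _ ⟨t, ht, rfl⟩
      rw [Set.uIcc_of_le hN'] at ht
      have := Real.log_pos (show (1 : ℝ) < t by linarith [ht.1])
      exact_mod_cast (by positivity : Real.log t / Real.log N ≠ 0))
  simp only [div_self hlN.ne'] at hsub
  rw [← hsub]
  have hcongr : ∫ t in (2 : ℝ)..N, (t⁻¹ / Real.log N) • (g ∘ fun t => Real.log t / Real.log N) t =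
      ∫ t in (2 : ℝ)..N, primeDensity ε t := by
    refine intervalIntegral.integral_congr fun t ht => ?_
    have ht0 := hpos t ht
    rw [Set.uIcc_of_le hN'] at ht
    have hlt := Real.log_pos (show (1 : ℝ) < t by linarith [ht.1])
    have hlNC : (Real.log N : ℂ) ≠ 0 := by exact_mod_cast hlN.ne'
    have hltC : (Real.log t : ℂ) ≠ 0 := by exact_mod_cast hlt.ne'
    have htC : (t : ℂ) ≠ 0 := by exact_mod_cast ht0.ne'
    have e : Complex.I * (lam : ℂ) * ((Real.log t / Real.log N : ℝ) : ℂ) =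
        Complex.I * ((ε * Real.log t : ℝ) : ℂ) := by
      rw [hlam]; simp only [Complex.ofReal_mul, Complex.ofReal_div]; field_simp
    simp only [Function.comp, hg, primeDensity, unitPow, e, Complex.real_smul]
    simp only [Complex.ofReal_div, Complex.ofReal_inv]
    field_simp
  rw [hcongr, add_sub_cancel_right]
  refine (intervalIntegral.norm_integral_le_of_norm_le_const fun v _ => hbound v).trans ?_
  rw [sub_zero, abs_of_pos hv0, hlam, hv, abs_mul, abs_of_pos hlN]
  have : |ε| * Real.log N * (Real.log 2 / Real.log N) = |ε| * Real.log 2 := by field_simp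
  rw [this]
  nlinarith [abs_nonneg ε, Real.log_two_lt_d9]

/-! ### Local factors -/

/-- The truncated geometric series. -/
noncomputable def geomSum (k : ℕ) (w : ℂ) : ℂ := ∑ j ∈ range k, w ^ j

/-- A zero would satisfy w^k = 1 by the geometric sum identity, impossible inside the unit disc. -/
theorem geomSum_ne_zero {k : ℕ} (hk : k ≠ 0) {w : ℂ} (hw : ‖w‖ < 1) : geomSum k w ≠ 0 := by
  intro h
  have h1 := geom_sum_mul w k
  rw [geomSum] at h
  rw [h, zero_mul] at h1
  have h2 : ‖w ^ k‖ < 1 := by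
    rw [norm_pow]; exact pow_lt_one₀ (norm_nonneg _) hw hk
  rw [sub_eq_zero.1 h1.symm, norm_one] at h2
  exact lt_irrefl _ h2

/-- `geomSum k w * exp (-w) = 1 + O(w ^ 2)`. -/
noncomputable def geomSumExp (k : ℕ) (w : ℂ) : ℂ := geomSum k w * Complex.exp (-w)

theorem contDiff_geomSumExp (k : ℕ) : ContDiff ℂ 2 (geomSumExp k) := by
  unfold geomSumExp geomSum
  fun_prop

/-- The factor e^{-w} cancels the linear coefficient of the geometric sum, which is 1 precisely
because k ≥ 2. -/
theorem deriv_geomSumExp_zero {k : ℕ} (hk : 2 ≤ k) : deriv (geomSumExp k) 0 = 0 := by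
  have h1 : HasDerivAt (geomSum k) (∑ j ∈ range k, (j : ℂ) * 0 ^ (j - 1)) 0 := by
    have := HasDerivAt.fun_sum (u := range k) (A := fun j (w : ℂ) => w ^ j)
      fun j _ => hasDerivAt_pow j (0 : ℂ)
    exact this
  have h2 : ∑ j ∈ range k, (j : ℂ) * 0 ^ (j - 1) = 1 := by
    rw [sum_eq_single 1]
    · simp
    · intro j _ hj
      rcases Nat.eq_zero_or_pos j with rfl | h
      · simp
      · rw [zero_pow (by omega), mul_zero]
    · intro h; simp at h; omega
  have h3 : geomSum k 0 = 1 := by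
    obtain ⟨m, rfl⟩ := Nat.exists_eq_succ_of_ne_zero (by omega : k ≠ 0)
    simp [geomSum, sum_range_succ']
  have h4 : HasDerivAt (fun w : ℂ => Complex.exp (-w)) (Complex.exp (-0) * -1) 0 :=
    (hasDerivAt_neg (0 : ℂ)).cexp
  have h5 := (h1.mul h4).deriv
  change deriv (geomSumExp k) 0 = _ at h5
  rw [h5, h2, h3]; simp

/-- Rotating the argument changes `geomSumExp` only to second order. -/
theorem exists_norm_geomSumExp_sub_le {k : ℕ} (hk : 2 ≤ k) :
    ∃ C : ℝ, 0 ≤ C ∧ ∀ z u : ℂ, ‖z‖ ≤ 1 → ‖u‖ = 1 →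
      ‖geomSumExp k (z * u) - geomSumExp k z‖ ≤ C * ‖z‖ ^ 2 * ‖u - 1‖ := by
  have hd1 : ContDiff ℂ 1 (deriv (geomSumExp k)) := by
    have : ContDiff ℂ (1 + 1) (geomSumExp k) := contDiff_geomSumExp k
    exact (contDiff_succ_iff_deriv.1 this).2.2
  have hdd : Continuous (deriv (deriv (geomSumExp k))) := hd1.continuous_deriv le_rfl
  obtain ⟨C, hC⟩ := (isCompact_closedBall (0 : ℂ) 1).exists_bound_of_continuousOn hdd.continuousOn
  have hC0 : 0 ≤ C := (norm_nonneg _).trans (hC 0 (by simp))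
  have hderiv : ∀ w : ℂ, ‖w‖ ≤ 1 → ‖deriv (geomSumExp k) w‖ ≤ C * ‖w‖ := fun w hw => by
    have := Convex.norm_image_sub_le_of_norm_deriv_le (f := deriv (geomSumExp k))
      (s := Metric.closedBall (0 : ℂ) 1) (x := 0) (y := w) (C := C)
      (fun x _ => (hd1.differentiable one_ne_zero).differentiableAt) hC (convex_closedBall _ _)
      (by simp) (by simpa using hw)
    simpa [deriv_geomSumExp_zero hk] using this
  refine ⟨C, hC0, fun z u hz hu => ?_⟩
  -- Both z and zu lie in the disc of radius ‖z‖, where the derivative is at most C‖z‖; the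
  -- displacement ‖z‖ ‖u - 1‖ supplies the second factor ‖z‖.
  have := Convex.norm_image_sub_le_of_norm_deriv_le (f := geomSumExp k)
    (s := Metric.closedBall (0 : ℂ) ‖z‖) (x := z) (y := z * u) (C := C * ‖z‖)
    (fun x _ => ((contDiff_geomSumExp k).differentiable two_ne_zero).differentiableAt)
    (fun w hw => by
      have hw' : ‖w‖ ≤ ‖z‖ := by simpa using hw
      exact (hderiv w (hw'.trans hz)).trans (mul_le_mul_of_nonneg_left hw' hC0))
    (convex_closedBall _ _) (by simp) (by simp [hu])
  refine this.trans (le_of_eq ?_)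
  rw [show z * u - z = z * (u - 1) by ring, norm_mul]
  ring

/-- The local factor at `p` is `exp ((α / p) (u - 1))` up to a second-order relative error. -/
theorem exists_geomSum_mul_eq {k : ℕ} (hk : 2 ≤ k) {α : ℂ} (hα : ‖α‖ < 2) :
    ∃ C : ℝ, 0 ≤ C ∧ ∀ p : ℕ, 2 ≤ p → ∀ u : ℂ, ‖u‖ = 1 → ∃ η : ℂ,
      ‖η‖ ≤ C * (‖u - 1‖ / (p : ℝ) ^ 2) ∧
      geomSum k (α / p * u) =
        geomSum k (α / p) * (Complex.exp (α / p * (u - 1)) * (1 + η)) := by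
  obtain ⟨C₁, hC₁, h₁⟩ := exists_norm_geomSumExp_sub_le hk
  have hne : ∀ w : ℂ, ‖w‖ < 1 → geomSumExp k w ≠ 0 := fun w hw =>
    mul_ne_zero (geomSum_ne_zero (by omega) hw) (Complex.exp_ne_zero _)
  -- Every α/p lies in this disc, whose radius is below 1 as ‖α‖ < 2, so the inverse is bounded
  -- uniformly in p.
  obtain ⟨C₂, hC₂⟩ := (isCompact_closedBall (0 : ℂ) (‖α‖ / 2)).exists_bound_of_continuousOn
    (f := fun w => (geomSumExp k w)⁻¹) ((contDiff_geomSumExp k).continuous.continuousOn.inv₀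
      fun w hw => hne w (by
        have : ‖w‖ ≤ ‖α‖ / 2 := by simpa using hw
        linarith))
  have hC₂0 : 0 ≤ C₂ := (norm_nonneg _).trans (hC₂ 0 (by simp; positivity))
  refine ⟨C₁ * ‖α‖ ^ 2 * C₂, by positivity, fun p hp u hu => ?_⟩
  have hp' : (2 : ℝ) ≤ p := by exact_mod_cast hp
  have hznorm : ‖α / p‖ = ‖α‖ / p := by rw [norm_div, Complex.norm_natCast]
  have hz : ‖α / p‖ ≤ ‖α‖ / 2 := by rw [hznorm]; gcongr
  set z := α / p
  refine ⟨(geomSumExp k (z * u) - geomSumExp k z) * (geomSumExp k z)⁻¹, ?_, ?_⟩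
  · rw [norm_mul]
    calc _ ≤ C₁ * ‖z‖ ^ 2 * ‖u - 1‖ * C₂ :=
          mul_le_mul (h₁ z u (by linarith) hu) (hC₂ z (by simpa using hz)) (norm_nonneg _)
            (by positivity)
      _ = C₁ * ‖α‖ ^ 2 * C₂ * (‖u - 1‖ / (p : ℝ) ^ 2) := by rw [hznorm]; field_simp
  · have h0 := hne z (by linarith)
    have hg0 := geomSum_ne_zero (k := k) (by omega) (show ‖z‖ < 1 by linarith)
    have e : (1 : ℂ) + (geomSumExp k (z * u) - geomSumExp k z) * (geomSumExp k z)⁻¹ =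
        geomSumExp k (z * u) / geomSumExp k z := by field_simp; ring
    have e' : Complex.exp (-(z * u)) = Complex.exp (-z) * (Complex.exp (z * (u - 1)))⁻¹ := by
      rw [← Complex.exp_neg, ← Complex.exp_add]; ring_nf
    rw [e, geomSumExp, geomSumExp, e']
    field_simp [Complex.exp_ne_zero]

/-! ### Euler product for the characteristic function -/

theorem prime_of_mem_primesUpTo {N p : ℕ} (hp : p ∈ primesUpTo N) : p.Prime := (mem_filter.1 hp).2

/-- The parametrization of the ensemble by exponent vectors is injective. -/
theorem injective_prod_pow (k N : ℕ) :
    Function.Injective fun ν : primesUpTo N → Fin k =>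
      ∏ p : primesUpTo N, (p : ℕ) ^ (ν p : ℕ) := by
  have hfac : ∀ (ν : primesUpTo N → Fin k) (q : primesUpTo N),
      (∏ p : primesUpTo N, (p : ℕ) ^ (ν p : ℕ)).factorization q = ν q := fun ν q => by
    rw [Nat.factorization_prod_apply fun p _ =>
      pow_ne_zero _ (prime_of_mem_primesUpTo p.2).ne_zero]
    rw [sum_eq_single q]
    · rw [(prime_of_mem_primesUpTo q.2).factorization_pow]; simp
    · intro p _ hpq
      rw [(prime_of_mem_primesUpTo p.2).factorization_pow, Finsupp.single_eq_of_ne]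
      exact fun h => hpq (Subtype.ext h.symm)
    · simp
  intro ν μ h
  funext q
  apply Fin.ext
  rw [← hfac ν q, ← hfac μ q]
  exact congrArg (fun n => Nat.factorization n q) h

/-- Euler product over the ensemble. -/
theorem sum_ensemble (k N : ℕ) {h : ℕ → ℂ} (h1 : h 1 = 1)
    (hmul : ∀ m n, m ≠ 0 → n ≠ 0 → h (m * n) = h m * h n) :
    ∑ x ∈ ensemble k N, h x = ∏ p ∈ primesUpTo N, geomSum k (h p) := by
  have hpow : ∀ m, m ≠ 0 → ∀ j, h (m ^ j) = h m ^ j := fun m hm j => by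
    induction j with
    | zero => simpa using h1
    | succ j ih => rw [pow_succ, hmul _ _ (pow_ne_zero _ hm) hm, ih, pow_succ]
  have hprod : ∀ (s : Finset (primesUpTo N)) (f : primesUpTo N → ℕ), (∀ i, f i ≠ 0) →
      h (∏ i ∈ s, f i) = ∏ i ∈ s, h (f i) := fun s f hf => by
    induction s using Finset.cons_induction with
    | empty => simpa using h1
    | cons a s ha ih =>
      rw [prod_cons, prod_cons, hmul _ _ (hf a) (prod_ne_zero_iff.2 fun i _ => hf i), ih]
  have hne : ∀ p : primesUpTo N, (p : ℕ) ≠ 0 := fun p => (prime_of_mem_primesUpTo p.2).ne_zero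
  rw [ensemble, sum_image fun ν _ μ _ h => injective_prod_pow k N h]
  rw [← prod_coe_sort]
  have e : ∀ p : primesUpTo N, geomSum k (h p) = ∑ j : Fin k, h p ^ (j : ℕ) := fun p =>
    (Fin.sum_univ_eq_sum_range (fun j => h p ^ j) k).symm
  simp_rw [e]
  rw [prod_univ_sum, Fintype.piFinset_univ]
  refine sum_congr rfl fun ν _ => ?_
  rw [hprod _ _ fun p => pow_ne_zero _ (hne p)]
  exact prod_congr rfl fun p _ => hpow _ (hne p) _

theorem sum_ensemble_unitPow (k N : ℕ) (α : ℂ) (ε : ℝ) :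
    ∑ x ∈ ensemble k N, α ^ ArithmeticFunction.cardFactors x / (x : ℂ) * unitPow ε x =
      ∏ p ∈ primesUpTo N, geomSum k (α / p * unitPow ε p) := by
  rw [sum_ensemble]
  · refine prod_congr rfl fun p hp => ?_
    rw [ArithmeticFunction.cardFactors_apply_prime (prime_of_mem_primesUpTo hp), pow_one]
  · simp
  · intro m n hm hn
    rw [ArithmeticFunction.cardFactors_mul hm hn, pow_add, Nat.cast_mul, Nat.cast_mul,
      unitPow_mul ε (by exact_mod_cast hm) (by exact_mod_cast hn)]
    have : (m : ℂ) ≠ 0 := by exact_mod_cast hm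
    have : (n : ℂ) ≠ 0 := by exact_mod_cast hn
    field_simp

theorem partitionFunction_eq (k N : ℕ) (α : ℂ) :
    partitionFunction k α N = ∏ p ∈ primesUpTo N, geomSum k (α / p) := by
  simpa [partitionFunction, cmeasure] using sum_ensemble_unitPow k N α 0

theorem charFn_eq (k N : ℕ) (α : ℂ) (t : ℝ) :
    charFn k α N t = (∏ p ∈ primesUpTo N, geomSum k (α / p))⁻¹ *
      ∏ p ∈ primesUpTo N, geomSum k (α / p * unitPow (t / Real.log N) p) := by
  rw [← sum_ensemble_unitPow, mul_sum, charFn, expectation]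
  refine sum_congr rfl fun x _ => ?_
  rw [normalizedMeasure, cmeasure, sum_singleton, partitionFunction_eq, xi, unitPow, mul_comm,
    mul_assoc]
  have e : Complex.I * (t : ℂ) * ((Real.log x / Real.log N : ℝ) : ℂ) =
      Complex.I * ((t / Real.log N * Real.log x : ℝ) : ℂ) := by
    simp only [Complex.ofReal_mul, Complex.ofReal_div]; ring
  rw [e]

theorem partitionFunction_ne_zero {k : ℕ} (hk : 2 ≤ k) {α : ℂ} (hα : ‖α‖ < 2) (N : ℕ) :
    ∏ p ∈ primesUpTo N, geomSum k (α / p) ≠ 0 := by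
  refine prod_ne_zero_iff.2 fun p hp => geomSum_ne_zero (by omega) ?_
  have hp2 : (2 : ℝ) ≤ p := by exact_mod_cast (prime_of_mem_primesUpTo hp).two_le
  rw [norm_div, Complex.norm_natCast, div_lt_one (by linarith)]
  linarith

/-- Compares log n with 2 √n. It bounds the total of the local errors, each O(|ε| log p / p²),
uniformly in N. -/
theorem summable_log_div_sq : Summable fun n : ℕ => Real.log n / (n : ℝ) ^ 2 := by
  refine Summable.of_nonneg_of_le (fun n => div_nonneg (Real.log_natCast_nonneg n) (by positivity))
    (fun n => ?_) ((Real.summable_nat_rpow.2 (by norm_num : (-(3 / 2) : ℝ) < -1)).mul_left 2)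
  rcases Nat.eq_zero_or_pos n with rfl | hn
  · simp
  · have hn0 : (0 : ℝ) < n := by exact_mod_cast hn
    have h1 := Real.log_le_rpow_div hn0.le (by norm_num : (0 : ℝ) < 1 / 2)
    rw [div_le_iff₀ (by positivity), ← Real.rpow_natCast, mul_assoc, ← Real.rpow_add hn0]
    norm_num at h1 ⊢
    linarith

theorem sum_primesUpTo_eq (N : ℕ) (ε : ℝ) :
    ∑ p ∈ primesUpTo N, (unitPow ε p - 1) / (p : ℂ) = ∑ n ∈ Ioc 0 N, primeTerm ε n := by
  have : primesUpTo N = (Ioc 0 N).filter Nat.Prime := by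
    ext p
    simp only [primesUpTo, mem_filter, mem_range, mem_Ioc]
    constructor
    · rintro ⟨h, hp⟩; exact ⟨⟨hp.pos, by omega⟩, hp⟩
    · rintro ⟨h, hp⟩; exact ⟨by omega, hp⟩
  rw [this, sum_filter]
  rfl

/-- The characteristic function in terms of the prime sum. -/
theorem exists_charFn_eq_exp_mul {k : ℕ} (hk : 2 ≤ k) {α : ℂ} (hα : ‖α‖ < 2) :
    ∃ C : ℝ, 0 ≤ C ∧ ∀ (N : ℕ) (ε t : ℝ), t / Real.log N = ε → |ε| ≤ 1 → ∃ P : ℂ,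
      ‖P - 1‖ ≤ C * |ε| ∧
      charFn k α N t = Complex.exp (α * ∑ n ∈ Ioc 0 N, primeTerm ε n) * P := by
  obtain ⟨C, hC0, hC⟩ := exists_geomSum_mul_eq hk hα
  set S := ∑' n : ℕ, Real.log n / (n : ℝ) ^ 2
  have hS0 : 0 ≤ S :=
    tsum_nonneg fun n => div_nonneg (Real.log_natCast_nonneg n) (by positivity)
  refine ⟨C * S * Real.exp (C * S), by positivity, fun N ε t ht hε => ?_⟩
  choose! η hη hηeq using fun (p : ℕ) (hp : 2 ≤ p) => hC p hp (unitPow ε p) (norm_unitPow ε p)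
  refine ⟨∏ p ∈ primesUpTo N, (1 + η p), ?_, ?_⟩
  · refine (norm_prod_one_add_sub_one_le _ _).trans ?_
    have hsum : ∑ p ∈ primesUpTo N, ‖η p‖ ≤ C * S * |ε| := by
      have h1 : ∀ p ∈ primesUpTo N, ‖η p‖ ≤ C * |ε| * (Real.log p / (p : ℝ) ^ 2) := fun p hp => by
        refine (hη p (prime_of_mem_primesUpTo hp).two_le).trans ?_
        have := norm_unitPow_sub_one_le ε p
        rw [abs_of_nonneg (Real.log_natCast_nonneg p)] at this
        calc C * (‖unitPow ε p - 1‖ / (p : ℝ) ^ 2) ≤ C * (|ε| * Real.log p / (p : ℝ) ^ 2) := by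
              gcongr
          _ = _ := by ring
      refine (sum_le_sum h1).trans ?_
      rw [← mul_sum]
      have h2 := summable_log_div_sq.sum_le_tsum (primesUpTo N) fun n _ =>
        div_nonneg (Real.log_natCast_nonneg n) (by positivity)
      calc _ ≤ C * |ε| * S := by gcongr
        _ = _ := by ring
    have hsum0 : 0 ≤ ∑ p ∈ primesUpTo N, ‖η p‖ := sum_nonneg fun p _ => norm_nonneg _
    have hexp : ∀ x : ℝ, Real.exp x - 1 ≤ x * Real.exp x := fun x => by
      have h1 := Real.add_one_le_exp (-x)
      have h2 : Real.exp (-x) * Real.exp x = 1 := by rw [← Real.exp_add]; simp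
      nlinarith [Real.exp_pos x]
    refine (hexp _).trans ?_
    calc _ ≤ C * S * |ε| * Real.exp (C * S) := by
          gcongr
          exact hsum.trans (mul_le_of_le_one_right (by positivity) hε)
      _ = _ := by ring
  · rw [charFn_eq, ht, inv_mul_eq_iff_eq_mul₀ (partitionFunction_ne_zero hk hα N),
      ← sum_primesUpTo_eq, mul_sum, Complex.exp_sum, ← prod_mul_distrib, ← prod_mul_distrib]
    refine prod_congr rfl fun p hp => ?_
    rw [hηeq p (prime_of_mem_primesUpTo hp).two_le]
    congr 3
    ring

/-! ### Assembly -/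

/-- The characteristic function relative to its limit. -/
theorem exists_charFn_eq_limitCharFn_mul {k : ℕ} (hk : 2 ≤ k) {α : ℂ} (hα : ‖α‖ < 2) :
    ∃ C : ℝ, 0 ≤ C ∧ ∀ N : ℕ, 2 ≤ N → ∀ ε t : ℝ, t / Real.log N = ε → ε ≠ 0 → |ε| ≤ 1 / 16 →
      ∃ R : ℂ, ‖R‖ ≤ C * (1 / Real.log N + |ε| * |Real.log (|ε|)|) ∧
        charFn k α N t = limitCharFn α t * (1 + R) := by
  obtain ⟨A, hA0, hA⟩ := exists_norm_sum_primeTerm_sub_integral_le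
  obtain ⟨B, hB0, hB⟩ := exists_charFn_eq_exp_mul hk hα
  -- From |e^z - 1| ≤ |z| e^{|z|} with |z| ≤ 2 (A + 1) s and s ≤ 3: the 2 bounds ‖α‖, and the extra
  -- 1 pays for the truncated integral.
  set A' := 2 * (A + 1) * Real.exp (2 * (A + 1) * 3) with hA'
  refine ⟨A' * (1 + B) + B, by positivity, fun N hN ε t ht hε hε1 => ?_⟩
  obtain ⟨P, hP, hPeq⟩ := hB N ε t ht (hε1.trans (by norm_num))
  have hN' : (2 : ℝ) ≤ N := by exact_mod_cast hN
  have hlN : 0 < Real.log N := Real.log_pos (by linarith)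
  have hε0 : 0 < |ε| := abs_pos.2 hε
  have hL1 := one_le_abs_log_abs hε hε1
  have hD := hA ε hε hε1 N hN
  set L := |Real.log (|ε|)|
  set s := 1 / Real.log N + |ε| * L
  have hεL : |ε| ≤ |ε| * L := le_mul_of_one_le_right hε0.le hL1
  have hinv : 0 < 1 / Real.log N := by positivity
  have hεs : |ε| ≤ s := by linarith
  have hs3 : s ≤ 3 := by
    have h1 : 1 / Real.log N ≤ 2 := by
      rw [div_le_iff₀ hlN]
      have := Real.log_le_log two_pos hN'
      linarith [Real.log_two_gt_d9]
    have h2 := Real.abs_log_mul_self_lt |ε| hε0 (hε1.trans (by norm_num))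
    rw [abs_mul, abs_abs, mul_comm] at h2
    linarith
  have hlam : t = ε * Real.log N := by rw [← ht, div_mul_cancel₀ _ hlN.ne']
  have hI := norm_integral_sub_integral_primeDensity_le ε hN
  rw [← hlam] at hI
  rw [hPeq, limitCharFn]
  set T := ∑ n ∈ Ioc 0 N, primeTerm ε n
  set J := ∫ v in (0 : ℝ)..1, (Complex.exp (Complex.I * (t : ℂ) * (v : ℂ)) - 1) / (v : ℂ)
  set J' := ∫ x in (2 : ℝ)..N, primeDensity ε x
  have hΔ : ‖α * (T - J)‖ ≤ 2 * (A + 1) * s := by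
    have h1 : ‖T - J‖ ≤ (A + 1) * s := by
      have e : T - J = (T - J') - (J - J') := by ring
      rw [e]
      refine (norm_sub_le _ _).trans ?_
      linarith
    rw [norm_mul, mul_assoc]
    exact mul_le_mul hα.le h1 (norm_nonneg _) zero_le_two
  refine ⟨Complex.exp (α * (T - J)) * P - 1, ?_, ?_⟩
  · have h1 : ‖Complex.exp (α * (T - J)) - 1‖ ≤ A' * s := by
      have h2 := Complex.norm_exp_sub_sum_le_norm_mul_exp (α * (T - J)) 1
      simp only [sum_range_one, pow_zero, Nat.factorial_zero, Nat.cast_one, div_one, pow_one] at h2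
      refine h2.trans ?_
      calc _ ≤ 2 * (A + 1) * s * Real.exp (2 * (A + 1) * 3) := by
            gcongr
            exact hΔ.trans (by gcongr)
        _ = _ := by rw [hA']; ring
    have h2 : ‖P‖ ≤ 1 + B := by
      have h3 := norm_le_norm_add_norm_sub 1 P
      rw [norm_one, norm_sub_rev] at h3
      nlinarith
    have e : Complex.exp (α * (T - J)) * P - 1 =
        (Complex.exp (α * (T - J)) - 1) * P + (P - 1) := by ring
    rw [e]
    refine (norm_add_le _ _).trans ?_
    rw [norm_mul]
    have h4 := mul_le_mul h1 h2 (norm_nonneg _) (by positivity)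
    have h5 := mul_le_mul_of_nonneg_left hεs hB0
    nlinarith
  · rw [add_sub_cancel, ← mul_assoc, ← Complex.exp_add]
    congr 2
    ring

end KFreeSmooth

theorem mainTheorem2 (k : ℕ) (hk : 2 ≤ k) (α : ℂ) (hα : ‖α‖ < 2) :
    ∃ C : ℝ, ∀ lam : ℕ → ℝ,
      Asymptotics.IsLittleO Filter.atTop lam (fun N : ℕ => Real.log (N : ℝ)) →
      ∀ᶠ N : ℕ in Filter.atTop, ∃ E₁ E₂ : ℂ,
        ‖E₁‖ ≤ C * (1 / Real.log (N : ℝ)) ∧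
        ‖E₂‖ ≤ C * abs (lam N / Real.log (N : ℝ) * Real.log (abs (lam N / Real.log (N : ℝ)))) ∧
        KFreeSmooth.charFn k α N (lam N) =
          KFreeSmooth.limitCharFn α (lam N) * (1 + E₁ + E₂) := by
  obtain ⟨C, hC0, hC⟩ := KFreeSmooth.exists_charFn_eq_limitCharFn_mul hk hα
  refine ⟨C, fun lam hlam => ?_⟩
  filter_upwards [hlam.bound (by norm_num : (0 : ℝ) < 1 / 16), Filter.eventually_ge_atTop 2]
    with N hN hN2
  have hlN : 0 < Real.log N := Real.log_pos (by exact_mod_cast (by omega : 1 < N))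
  have hε1 : |lam N / Real.log N| ≤ 1 / 16 := by
    rw [Real.norm_eq_abs, Real.norm_eq_abs] at hN
    rwa [abs_div, div_le_iff₀ (abs_pos.2 hlN.ne')]
  -- At λ = 0 both characteristic functions equal 1; the estimates in 1 / |ε| do not apply there.
  rcases eq_or_ne (lam N) 0 with h0 | h0
  · refine ⟨0, 0, by rw [norm_zero]; positivity, by rw [norm_zero]; positivity, ?_⟩
    rw [h0, KFreeSmooth.charFn_eq]
    simp only [zero_div, KFreeSmooth.unitPow_zero, mul_one]
    rw [inv_mul_cancel₀ (KFreeSmooth.partitionFunction_ne_zero hk hα N)]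
    simp [KFreeSmooth.limitCharFn]
  · obtain ⟨R, hR, hReq⟩ := hC N hN2 _ (lam N) rfl (div_ne_zero h0 hlN.ne') hε1
    set a := 1 / Real.log N with ha
    set b := |lam N / Real.log N| * |Real.log (|lam N / Real.log N|)| with hb
    have ha0 : 0 < a := by positivity
    have hb0 : 0 ≤ b := by positivity
    have hab : 0 < a + b := by positivity
    -- A single error of size C (a + b) is shared out in proportion to a and b.
    refine ⟨R * ((a / (a + b) : ℝ) : ℂ), R * ((b / (a + b) : ℝ) : ℂ), ?_, ?_, ?_⟩
    · rw [norm_mul, Complex.norm_real, Real.norm_of_nonneg (by positivity)]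
      refine (mul_le_mul_of_nonneg_right hR (by positivity)).trans (le_of_eq ?_)
      field_simp
    · rw [norm_mul, Complex.norm_real, Real.norm_of_nonneg (by positivity), abs_mul, ← hb]
      refine (mul_le_mul_of_nonneg_right hR (by positivity)).trans (le_of_eq ?_)
      field_simp
    · rw [hReq, add_assoc, ← mul_add, ← Complex.ofReal_add, ← add_div, div_self hab.ne',
        Complex.ofReal_one, mul_one]
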